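/- **Setting.** Let $d\ge 1$ and $|\mathbf k|=\max_v|k_v|$, $\langle\mathbf k\rangle=\max\{1,|\mathbf k|\}$ for $\mathbf k\in\mathbb Z^d$. Let $(\mathfrak B,\|\cdot\|_{\mathfrak B})$ be a translation invariant Banach algebra of complex sequences on $\mathbb Z^d$: a Banach algebra under pointwise operations, containing the constant sequence $1$ with norm $1$, and such that $\|\sigma_{\mathbf j}a\|_{\mathfrak B}=\|a\|_{\mathfrak B}$ for all $a\in\mathfrak B$, $\mathbf j\in\mathbb Z^d$, where $(\sigma_{\mathbf j}a)_{\mathbf i}=a_{\mathbf i-\mathbf j}$. A complex sequence $p$ (not necessarily in $\mathfrak B$), or the diagonal matrix with entries $p$, is $(\tau,\gamma)$-distal, written $p\in DC_{\mathfrak B}(\tau,\gamma)$, if for every $\mathbf k\ne\mathbf 0$ the sequence $p-\sigma_{\mathbf k}p$ has no zero entry and its pointwise inverse lies in $\mathfrak B$ with $\|(p-\sigma_{\mathbf k}p)^{-1}\|_{\mathfrak B}\le\gamma^{-1}|\mathbf k|^{\tau}$. For a matrix $A=(a_{\mathbf i,\mathbf j})_{\mathbf i,\mathbf j\in\mathbb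 Z^d}$ put $A_{\mathbf k}=(a_{\mathbf i,\mathbf i-\mathbf k})_{\mathbf i}$; $\mathcal M^s$ is the set of $A$ with all $A_{\mathbf k}\in\mathfrak B$ and $\|A\|_s^2=\sum_{\mathbf k}\|A_{\mathbf k}\|_{\mathfrak B}^2\langle\mathbf k\rangle^{2s}<\infty$, and $\mathcal M_0^\infty$ is the set of diagonal matrices in $\bigcap_{s\ge0}\mathcal M^s$. **Theorem 2.2 (direct reducibility).** Fix $\delta>0$, $\alpha_0>d/2$, $\tau>0$, $\gamma>0$, $\eta>0$ and $\alpha>\alpha_0+\tau+7\delta$. There are $C=C(\delta,\tau,\alpha_0,\alpha)>0$ and $\epsilon_0=\epsilon_0(\eta,\delta,\tau,\gamma,\alpha_0,\alpha)>0$ such that the following holds. Let $D$ be a diagonal matrix such that $D+D'\in DC_{\mathfrak B}(\tau,\gamma)$ for every $D'\in\mathcal M_0^\infty$ with $\|D'\|_0\le\eta$, and let $T\in\mathcal M^{\alpha+4\delta}$ with $\|T\|_{\alpha+4\delta}\le\epsilon_0$. Then there are an invertible $Q_+$ with $Q_+,Q_+^{-1}\in\mathcal M^{\alpha-\tau-7\delta}$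 and $D_+\in\mathcal M_0^\infty$ such that $$Q_+^{-1}(T+D)Q_+=D+D_+$$ and $$\|Q_+-I\|_{\alpha-\tau-7\delta}\le C\|T\|_{\alpha+4\delta}^{\frac{\delta}{\alpha-\alpha_0}},\qquad \|Q_+^{-1}-I\|_{\alpha-\tau-7\delta}\le C\|T\|_{\alpha+4\delta}^{\frac{\delta}{\alpha-\alpha_0}},\qquad \|D_+\|_0\le C\|T\|_{\alpha+4\delta};$$ if $\alpha-\alpha_0\ge1$, then also $\|D_+\|_0\le C\|T\|_{\alpha+4\delta}^{\frac1{\alpha-\alpha_0}}$. Moreover, if both $T$ and $D$ are real symmetric, then $Q_+^tQ_+$ has a positive inverse square root in $\mathcal M^{\alpha-\tau-7\delta}$, the matrix $U=Q_+(Q_+^tQ_+)^{-1/2}\in\mathcal M^{\alpha-\tau-7\delta}$ is a unitary operator on $\ell^2(\mathbb Z^d)$, and $$U^{-1}(T+D)U=D+D_+,\qquad \|U-I\|_{\alpha-\tau-7\delta}\le C\|T\|_{\alpha+4\delta}^{\frac{\delta}{\alpha-\alpha_0}}.$$ -/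

import Mathlib

open Filter Topology
open scoped Matrix ComplexOrder

/-- The lattice `ℤ^d`. Its Mathlib norm `‖k‖` is the sup norm `max |k_v|`. -/
abbrev ZLat (d : ℕ) : Type := Fin d → ℤ

/-- Complex matrices indexed by `ℤ^d × ℤ^d`. -/
abbrev LatMat (d : ℕ) : Type := Matrix (ZLat d) (ZLat d) ℂ

/-- The translation `(σ_j a)_i = a_{i-j}`. -/
def latShift {d : ℕ} (j : ZLat d) (a : ZLat d → ℂ) : ZLat d → ℂ := fun i => a (i - j)

/-- A translation invariant Banach algebra of complex sequences indexed by `ℤ^d`, with pointwise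
operations: a unital subalgebra of all sequences, with a complete submultiplicative norm such that
the constant sequence `1` has norm `1` and such that all translations act isometrically. -/
structure TransInvBanachAlg (d : ℕ) where
  carrier : Subalgebra ℂ (ZLat d → ℂ)
  nrm : AlgebraNorm ℂ carrier
  complete : ∀ u : ℕ → carrier,
    (∀ ε : ℝ, 0 < ε → ∃ N : ℕ, ∀ m n : ℕ, N ≤ m → N ≤ n → nrm (u m - u n) < ε) →
    ∃ a : carrier, Tendsto (fun n => nrm (u n - a)) atTop (𝓝 0)
  norm_one : nrm 1 = 1
  shift_mem : ∀ (j : ZLat d) (a : carrier), latShift j (a : ZLat d → ℂ) ∈ carrier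
  norm_shift : ∀ (j : ZLat d) (a : carrier), nrm ⟨latShift j (a : ZLat d → ℂ), shift_mem j a⟩ = nrm a

namespace TransInvBanachAlg

variable {d : ℕ} (B : TransInvBanachAlg d)

open Classical in
/-- The norm of `B` as a function of a sequence. It is meaningful only for members of `B`; every
use below is accompanied by the membership. -/
noncomputable def seqNorm (a : ZLat d → ℂ) : ℝ :=
  if h : a ∈ B.carrier then B.nrm ⟨a, h⟩ else 0

/-- `p` is a `(τ, γ)`-distal sequence for `B`: for every `k ≠ 0` the sequence `p - σ_k p` has no
zero entry, and its pointwise inverse belongs to `B` with norm at most `γ⁻¹ |k|^τ`. -/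
def Distal (τ γ : ℝ) (p : ZLat d → ℂ) : Prop :=
  ∀ k : ZLat d, k ≠ 0 →
    (∀ i, p i - latShift k p i ≠ 0) ∧
    (fun i => (p i - latShift k p i)⁻¹) ∈ B.carrier ∧
    B.seqNorm (fun i => (p i - latShift k p i)⁻¹) ≤ γ⁻¹ * ‖k‖ ^ τ

end TransInvBanachAlg

/-- The `k`-diagonal `A_k = (a_{i, i-k})_i` of a matrix. -/
def kDiag {d : ℕ} (A : LatMat d) (k : ZLat d) : ZLat d → ℂ := fun i => A i (i - k)

/-- The weight `⟨k⟩ = max {1, |k|}`. -/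
noncomputable def japanese {d : ℕ} (k : ZLat d) : ℝ := max 1 ‖k‖

namespace TransInvBanachAlg

variable {d : ℕ} (B : TransInvBanachAlg d)

/-- `A ∈ M^s`: all diagonals of `A` belong to `B`, and
`∑_k ‖A_k‖_B ^ 2 ⟨k⟩ ^ (2 s)` is finite. -/
def MemSob (s : ℝ) (A : LatMat d) : Prop :=
  (∀ k, kDiag A k ∈ B.carrier) ∧
    Summable (fun k : ZLat d => B.seqNorm (kDiag A k) ^ 2 * japanese k ^ (2 * s))

/-- The Sobolev norm `‖A‖_s`, meaningful for `A ∈ M^s`. -/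
noncomputable def sobNorm (s : ℝ) (A : LatMat d) : ℝ :=
  Real.sqrt (∑' k : ZLat d, B.seqNorm (kDiag A k) ^ 2 * japanese k ^ (2 * s))

/-- `A ∈ M_0^∞`: `A` belongs to `M^s` for all `s ≥ 0` and is a diagonal matrix. -/
def MemDiagInf (A : LatMat d) : Prop :=
  (∀ s : ℝ, 0 ≤ s → B.MemSob s A) ∧ A = Matrix.diagonal (fun i => A i i)

end TransInvBanachAlg

/-- `C` is the product `X Y` of infinite matrices, all the defining series being (absolutely)
convergent. -/
def IsProd {d : ℕ} (X Y C : LatMat d) : Prop :=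
  ∀ i j, HasSum (fun k => X i k * Y k j) (C i j)

/-- `C` is the product `X Y Z` of infinite matrices, all the defining double series being
(absolutely) convergent. -/
def IsTripleProd {d : ℕ} (X Y Z C : LatMat d) : Prop :=
  ∀ i j, HasSum (fun kl : ZLat d × ZLat d => X i kl.1 * Y kl.1 kl.2 * Z kl.2 j) (C i j)

/-- `Y` is the two-sided inverse of `X`. -/
def IsMatInv {d : ℕ} (X Y : LatMat d) : Prop := IsProd X Y 1 ∧ IsProd Y X 1

/-- All entries of the matrix are real and the matrix is symmetric. -/
def IsRealSymm {d : ℕ} (A : LatMat d) : Prop := (∀ i j, (A i j).im = 0) ∧ Aᵀ = A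

/-- The matrix `U` represents a unitary operator on `ℓ²(ℤ^d)` in the standard basis. -/
def IsUnitaryMat {d : ℕ} (U : LatMat d) : Prop :=
  ∃ V : lp (fun _ : ZLat d => ℂ) 2 ≃ₗᵢ[ℂ] lp (fun _ : ZLat d => ℂ) 2,
    ∀ i j, (V (lp.single 2 j (1 : ℂ)) : ZLat d → ℂ) i = U i j

/-- `S = G^{-1/2}`: `S` is positive semidefinite and `S²` is the inverse of `G`. Such an `S` is
unique among matrices that define bounded operators on `ℓ²(ℤ^d)`, in particular among the
matrices in `M^s` with `s > d/2`. -/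
def IsInvSqrt {d : ℕ} (G S : LatMat d) : Prop :=
  S.PosSemidef ∧ ∃ P : LatMat d, IsProd S S P ∧ IsMatInv G P

open scoped ENNReal

/-! ### Sums of squares in the extended nonnegative reals, and weighted convolution -/

section EllTwo

variable {ι : Type*}

/-! The theorem is proved by a KAM iteration with smoothing. The relation $(T+p)Q=Q(p+D)$ is written
$[p,Q]=QD-TQ$, so that the possibly unbounded diagonal $p$ enters only through the entries
$(p_i-p_j)Q_{ij}$ (`LatOp.IsAd`), while all other factors are bounded operators on $\ell^1$
(`LatOp`). Suppose $Q$ conjugates up to a remainder $R$, with a diagonal $u$ already collected.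
Distality of $p+u$ allows $[p+u,W]=\operatorname{diag}R-R$ to be solved one diagonal at a time, at
the cost of a factor $\gamma^{-1}|k|^\tau$ (`exists_homological`). Replacing $Q$ by $Q(1+W)$ then
leaves an error quadratic in $R$ (`reducibility_step`).

The loss $|k|^\tau$ is paid for by the weights $c\langle k\rangle^{\alpha_0}e^{2^{-n}|k|}$: going
from $n$ to $n+1$ frees a factor $e^{2^{-n-1}|k|}$, which absorbs $|k|^\tau$ at the price $2^{\tau
n}$ (`japanese_rpow_le_exp`). Since $T$ has no exponential decay, stage $n$ sees only its diagonals
$|k|\le 2^n$, where the exponential is at most $e$ (`exists_band_approx`). Each enlargement of the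
band adds an error of order $2^{-bn}\epsilon$ with $b=\alpha+4\delta-\alpha_0$, and this sets the
rate: $R_n\sim 2^{-bn}\epsilon$ and $W_n\sim\gamma^{-1}2^{(\tau-b)n}\epsilon$. Returning to the
weight $\langle k\rangle^s$ with $s=\alpha-\tau-7\delta$ costs $2^{(s-\alpha_0)n}$, and the
corrections are summable because $s-\alpha_0+\tau<b$ (`exists_reducibility_const`). The resulting
bounds are linear in $\gamma^{-1}\epsilon$; for small $\epsilon$ they turn into the stated power
with a constant free of $\gamma$ (`inv_mul_le_rpow`).

Products are controlled because the weights satisfy a Beurling condition, which makes the weighted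
$\ell^2$ norm of the diagonals submultiplicative (`isAlgWeight_expWeight`, `wnorm_mul_le`).

For real symmetric data $Q^tQ$ commutes with $p+u$, whose entries are distinct, so it is diagonal.
Its inverse square root is then a power series in a small element of $\mathfrak B$
(`exists_unitary_reducibility`). Realness is carried along by making the norms infinite outside a
closed subfield $K$ of $\mathbb C$. -/

theorem ENNReal.sq_le_sq_iff {a b : ℝ≥0∞} : a ^ 2 ≤ b ^ 2 ↔ a ≤ b :=
  (ENNReal.pow_right_strictMono two_ne_zero).le_iff_le

/-- The `ℓ²` norm of a family of extended nonnegative reals. -/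
noncomputable def ellTwo (f : ι → ℝ≥0∞) : ℝ≥0∞ := (∑' i, f i ^ 2) ^ (1 / 2 : ℝ)

theorem ellTwo_sq (f : ι → ℝ≥0∞) : ellTwo f ^ 2 = ∑' i, f i ^ 2 := by
  rw [ellTwo, ← ENNReal.rpow_natCast, ← ENNReal.rpow_mul]
  norm_num

theorem le_ellTwo_iff {f : ι → ℝ≥0∞} {x : ℝ≥0∞} : ellTwo f ≤ x ↔ ∑' i, f i ^ 2 ≤ x ^ 2 := by
  rw [← ellTwo_sq]
  exact ENNReal.sq_le_sq_iff.symm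

theorem ellTwo_mono {f g : ι → ℝ≥0∞} (h : ∀ i, f i ≤ g i) : ellTwo f ≤ ellTwo g := by
  rw [le_ellTwo_iff, ellTwo_sq]
  exact ENNReal.tsum_le_tsum fun i => pow_le_pow_left' (h i) 2

theorem ellTwo_const_mul (c : ℝ≥0∞) (f : ι → ℝ≥0∞) :
    ellTwo (fun i => c * f i) = c * ellTwo f := by
  have h : ellTwo (fun i => c * f i) ^ 2 = (c * ellTwo f) ^ 2 := by
    rw [mul_pow, ellTwo_sq, ellTwo_sq, ← ENNReal.tsum_mul_left]
    simp only [mul_pow]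
  exact (ENNReal.pow_right_strictMono two_ne_zero).injective h

theorem ellTwo_equiv {κ : Type*} (e : κ ≃ ι) (f : ι → ℝ≥0∞) :
    ellTwo (fun i => f (e i)) = ellTwo f := by
  simp only [ellTwo]
  rw [e.tsum_eq (fun i => f i ^ 2)]

theorem le_ellTwo (f : ι → ℝ≥0∞) (i : ι) : f i ≤ ellTwo f := by
  rw [← ENNReal.sq_le_sq_iff, ellTwo_sq]
  exact ENNReal.le_tsum i

theorem ellTwo_add_le (f g : ι → ℝ≥0∞) :
    ellTwo (fun i => f i + g i) ≤ ellTwo f + ellTwo g := by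
  let : MeasurableSpace ι := ⊤
  have := ENNReal.lintegral_Lp_add_le (μ := MeasureTheory.Measure.count) (f := f) (g := g)
    (p := 2) measurable_from_top.aemeasurable measurable_from_top.aemeasurable (by norm_num)
  simpa [MeasureTheory.lintegral_count, ellTwo] using this

theorem ENNReal.sq_tsum_mul_le (f g : ι → ℝ≥0∞) :
    (∑' i, f i * g i) ^ 2 ≤ (∑' i, f i ^ 2) * ∑' i, g i ^ 2 := by
  let : MeasurableSpace ι := ⊤
  have := ENNReal.lintegral_mul_le_Lp_mul_Lq (μ := MeasureTheory.Measure.count) (f := f) (g := g)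
    (p := 2) (q := 2) (by constructor <;> norm_num) measurable_from_top.aemeasurable
    measurable_from_top.aemeasurable
  have h : ∑' i, f i * g i ≤ ellTwo f * ellTwo g := by
    simpa [MeasureTheory.lintegral_count, ellTwo] using this
  calc _ ≤ (ellTwo f * ellTwo g) ^ 2 := pow_le_pow_left' h 2
    _ = _ := by rw [mul_pow, ellTwo_sq, ellTwo_sq]

theorem ellTwo_zero : ellTwo (fun _ : ι => (0 : ℝ≥0∞)) = 0 := by
  simp [ellTwo]

theorem ellTwo_sum_le {κ : Type*} (s : Finset κ) (f : κ → ι → ℝ≥0∞) :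
    ellTwo (fun i => ∑ n ∈ s, f n i) ≤ ∑ n ∈ s, ellTwo (f n) := by
  classical
  induction s using Finset.induction_on with
  | empty => simp [ellTwo_zero]
  | insert a s ha ih =>
    simp only [Finset.sum_insert ha]
    exact (ellTwo_add_le _ _).trans (add_le_add_right ih _)

/-- Only finitely many coordinates need to be tested at a time, and on those the finite Minkowski
inequality passes to the limit. -/
theorem ellTwo_tsum_le {κ : Type*} (f : κ → ι → ℝ≥0∞) :
    ellTwo (fun i => ∑' n, f n i) ≤ ∑' n, ellTwo (f n) := by
  classical
  rw [le_ellTwo_iff, ENNReal.tsum_eq_iSup_sum]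
  refine iSup_le fun s => ?_
  have ht : Tendsto (fun t : Finset κ => ∑ i ∈ s, (∑ n ∈ t, f n i) ^ 2) atTop
      (𝓝 (∑ i ∈ s, (∑' n, f n i) ^ 2)) := by
    refine tendsto_finsetSum _ fun i _ => ?_
    exact ((ENNReal.continuous_pow 2).tendsto _).comp ENNReal.summable.hasSum
  refine le_of_tendsto' ht fun t => ?_
  calc ∑ i ∈ s, (∑ n ∈ t, f n i) ^ 2 ≤ ∑' i, (∑ n ∈ t, f n i) ^ 2 := ENNReal.sum_le_tsum s
    _ = ellTwo (fun i => ∑ n ∈ t, f n i) ^ 2 := (ellTwo_sq _).symm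
    _ ≤ _ := pow_le_pow_left' ((ellTwo_sum_le t f).trans (ENNReal.sum_le_tsum t)) 2

/-- Convolution is bounded on a weighted `ℓ²` space as soon as the weight satisfies a
Beurling type condition. -/
theorem ellTwo_conv_le {G : Type*} [AddCommGroup G] (w f g : G → ℝ≥0∞)
    (hw0 : ∀ k, w k ≠ 0) (hwt : ∀ k, w k ≠ ⊤)
    (hw : ∀ k, ∑' l, (w k * ((w l)⁻¹ * (w (k - l))⁻¹)) ^ 2 ≤ 1) :
    ellTwo (fun k => (∑' l, f l * g (k - l)) * w k) ≤
      ellTwo (fun k => f k * w k) * ellTwo (fun k => g k * w k) := by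
  rw [le_ellTwo_iff, mul_pow, ellTwo_sq, ellTwo_sq]
  have h1 : ∀ k, ((∑' l, f l * g (k - l)) * w k) ^ 2 ≤
      ∑' l, (f l * w l) ^ 2 * (g (k - l) * w (k - l)) ^ 2 := by
    intro k
    -- Isolating the kernel $w(k)/(w(l)w(k-l))$ prepares Cauchy–Schwarz in $l$; the hypothesis `hw`
    -- says exactly that this kernel has $\ell^2$ norm at most one.
    have h2 : (∑' l, f l * g (k - l)) * w k = ∑' l, (w k * ((w l)⁻¹ * (w (k - l))⁻¹)) *
        ((f l * w l) * (g (k - l) * w (k - l))) := by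
      rw [← ENNReal.tsum_mul_right]
      refine tsum_congr fun l => ?_
      have e1 := ENNReal.inv_mul_cancel (hw0 l) (hwt l)
      have e2 := ENNReal.inv_mul_cancel (hw0 (k - l)) (hwt (k - l))
      calc f l * g (k - l) * w k = w k * f l * g (k - l) * 1 * 1 := by ring
        _ = w k * f l * g (k - l) * ((w l)⁻¹ * w l) * ((w (k - l))⁻¹ * w (k - l)) := by
          rw [e1, e2]
        _ = _ := by ring
    rw [h2]
    refine (ENNReal.sq_tsum_mul_le _ _).trans ?_
    refine (mul_le_mul' (hw k) le_rfl).trans ?_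
    rw [one_mul]
    exact ENNReal.tsum_le_tsum fun l => (mul_pow _ _ 2).le
  refine (ENNReal.tsum_le_tsum h1).trans ?_
  rw [ENNReal.tsum_comm]
  refine le_of_eq ?_
  rw [← ENNReal.tsum_mul_right]
  refine tsum_congr fun l => ?_
  rw [ENNReal.tsum_mul_left]
  congr 1
  exact (Equiv.subRight l).tsum_eq (fun k => (g k * w k) ^ 2)

end EllTwo

/-! ### The Banach algebra of sequences and its extended norm -/

namespace TransInvBanachAlg

variable {d : ℕ} (B : TransInvBanachAlg d)

/-- The members of `B`, with the topology of the norm of `B` (the subtype topology would be the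
one of pointwise convergence). -/
def Elem : Type := B.carrier

noncomputable instance : NormedCommRing B.Elem :=
  { B.nrm.toRingNorm.toNormedRing, (inferInstance : CommRing B.carrier) with }

noncomputable instance : NormedAlgebra ℂ B.Elem :=
  { (inferInstance : Algebra ℂ B.carrier) with
    norm_smul_le := fun r x => (map_smul_eq_mul B.nrm r x).le }

instance : NormOneClass B.Elem := ⟨B.norm_one⟩

/-- The inclusion of `B` into the algebra of all sequences. -/
def Elem.toSeq : B.Elem →ₐ[ℂ] (ZLat d → ℂ) := B.carrier.val

variable {B} in
theorem Elem.toSeq_mem (a : B.Elem) : Elem.toSeq B a ∈ B.carrier :=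
  Subtype.prop (p := (· ∈ B.carrier)) a

theorem seqNorm_of_mem {a : ZLat d → ℂ} (h : a ∈ B.carrier) : B.seqNorm a = B.nrm ⟨a, h⟩ :=
  dif_pos h

instance : CompleteSpace B.Elem := by
  refine Metric.complete_of_cauchySeq_tendsto fun u hu => ?_
  obtain ⟨a, ha⟩ := B.complete u (by
    intro ε hε
    obtain ⟨N, hN⟩ := Metric.cauchySeq_iff.1 hu ε hε
    exact ⟨N, fun m n hm hn => lt_of_eq_of_lt (dist_eq_norm (u m) (u n)).symm (hN m hm n hn)⟩)
  exact ⟨a, tendsto_iff_norm_sub_tendsto_zero.2 ha⟩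

/-- Evaluation at a point is a character, and characters of a complete normed algebra with $\|1\|=1$
are contractive. -/
theorem norm_apply_le (a : B.Elem) (i : ZLat d) : ‖Elem.toSeq B a i‖ ≤ ‖a‖ :=
  AlgHom.norm_apply_le_self ((Pi.evalAlgHom ℂ (fun _ : ZLat d => ℂ) i).comp (Elem.toSeq B)) a

theorem nrm_nonneg (a : B.carrier) : 0 ≤ B.nrm a := apply_nonneg B.nrm a

theorem seqNorm_nonneg (a : ZLat d → ℂ) : 0 ≤ B.seqNorm a := by
  unfold seqNorm
  split_ifs
  · exact B.nrm_nonneg _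
  · exact le_rfl

variable (K : Subfield ℂ)

open Classical in
/-- The norm of a sequence as an extended nonnegative real: infinite unless the sequence belongs
to `B` and has all its entries in `K`. -/
noncomputable def bnorm (a : ZLat d → ℂ) : ℝ≥0∞ :=
  if a ∈ B.carrier ∧ ∀ i, a i ∈ K then ENNReal.ofReal (B.seqNorm a) else ⊤

variable {B K}

theorem bnorm_eq {a : ZLat d → ℂ} (ha : a ∈ B.carrier) (hK : ∀ i, a i ∈ K) :
    B.bnorm K a = ENNReal.ofReal (B.seqNorm a) := if_pos ⟨ha, hK⟩

theorem bnorm_ne_top_iff {a : ZLat d → ℂ} :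
    B.bnorm K a ≠ ⊤ ↔ a ∈ B.carrier ∧ ∀ i, a i ∈ K := by
  unfold bnorm
  split_ifs with h <;> simp [h]

theorem bnorm_cases (a : ZLat d → ℂ) : B.bnorm K a = ⊤ ∨
    ∃ (h : a ∈ B.carrier), (∀ i, a i ∈ K) ∧ B.bnorm K a = ENNReal.ofReal (B.nrm ⟨a, h⟩) := by
  by_cases h : B.bnorm K a = ⊤
  · exact Or.inl h
  · have h' := bnorm_ne_top_iff.1 h
    exact Or.inr ⟨h'.1, h'.2, by rw [bnorm_eq h'.1 h'.2, B.seqNorm_of_mem h'.1]⟩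

theorem enorm_apply_le_bnorm (a : ZLat d → ℂ) (i : ZLat d) : ‖a i‖ₑ ≤ B.bnorm K a := by
  rcases bnorm_cases (B := B) (K := K) a with h | ⟨h, -, h'⟩
  · simp [h]
  · rw [h', ← ofReal_norm]
    exact ENNReal.ofReal_le_ofReal (B.norm_apply_le (⟨a, h⟩ : B.carrier) i)

theorem bnorm_zero : B.bnorm K 0 = 0 := by
  rw [bnorm_eq (zero_mem _) (fun _ => zero_mem _), B.seqNorm_of_mem (zero_mem _)]
  have : (⟨0, zero_mem _⟩ : B.carrier) = 0 := rfl
  rw [this, map_zero, ENNReal.ofReal_zero]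

theorem bnorm_one : B.bnorm K 1 = 1 := by
  rw [bnorm_eq (one_mem _) (fun _ => one_mem _), B.seqNorm_of_mem (one_mem _)]
  have : (⟨1, one_mem _⟩ : B.carrier) = 1 := rfl
  rw [this, B.norm_one, ENNReal.ofReal_one]

/-- The convention $0\cdot\infty=0$ does no harm: by `enorm_apply_le_bnorm` the extended norm
vanishes only at the zero sequence, and then the product is zero as well. -/
theorem bnorm_mul_le (a b : ZLat d → ℂ) :
    B.bnorm K (a * b) ≤ B.bnorm K a * B.bnorm K b := by
  rcases bnorm_cases (B := B) (K := K) a with h | ⟨h, hK, h'⟩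
  · by_cases hb : b = 0
    · simp [hb, bnorm_zero]
    · have : B.bnorm K b ≠ 0 := by
        obtain ⟨i, hi⟩ := Function.ne_iff.1 hb
        have := enorm_apply_le_bnorm (B := B) (K := K) b i
        intro h0
        rw [h0] at this
        simp at this
        exact hi this
      rw [h, ENNReal.top_mul this]
      exact le_top
  rcases bnorm_cases (B := B) (K := K) b with k | ⟨k, kK, k'⟩
  · by_cases hb : a = 0
    · simp [hb, bnorm_zero]
    · have : B.bnorm K a ≠ 0 := by
        obtain ⟨i, hi⟩ := Function.ne_iff.1 hb
        have := enorm_apply_le_bnorm (B := B) (K := K) a i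
        intro h0
        rw [h0] at this
        simp at this
        exact hi this
      rw [k, ENNReal.mul_top this]
      exact le_top
  rw [h', k', bnorm_eq (mul_mem h k) (fun i => mul_mem (hK i) (kK i)),
    B.seqNorm_of_mem (mul_mem h k), ← ENNReal.ofReal_mul (B.nrm_nonneg _)]
  exact ENNReal.ofReal_le_ofReal (map_mul_le_mul B.nrm ⟨a, h⟩ ⟨b, k⟩)

theorem bnorm_neg (a : ZLat d → ℂ) : B.bnorm K (-a) = B.bnorm K a := by
  have key : ∀ a : ZLat d → ℂ, B.bnorm K (-a) ≤ B.bnorm K a := by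
    intro a
    rcases bnorm_cases (B := B) (K := K) a with h | ⟨h, hK, h'⟩
    · simp [h]
    · rw [h', bnorm_eq (neg_mem h) (fun i => neg_mem (hK i)), B.seqNorm_of_mem (neg_mem h)]
      exact (congrArg ENNReal.ofReal (map_neg_eq_map B.nrm ⟨a, h⟩)).le
  exact le_antisymm (key a) (by simpa using key (-a))

theorem bnorm_shift (j : ZLat d) (a : ZLat d → ℂ) : B.bnorm K (latShift j a) = B.bnorm K a := by
  have key : ∀ (j : ZLat d) (a : ZLat d → ℂ), B.bnorm K (latShift j a) ≤ B.bnorm K a := by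
    intro j a
    rcases bnorm_cases (B := B) (K := K) a with h | ⟨h, hK, h'⟩
    · simp [h]
    · rw [h', bnorm_eq (B.shift_mem j ⟨a, h⟩) (fun i => hK _),
        B.seqNorm_of_mem (B.shift_mem j ⟨a, h⟩), B.norm_shift j ⟨a, h⟩]
  refine le_antisymm (key j a) ?_
  have h := key (-j) (latShift j a)
  have e : latShift (-j) (latShift j a) = a := by
    funext i
    simp [latShift]
  rwa [e] at h

/-- Countable subadditivity of `bnorm` along pointwise convergent series. -/
theorem bnorm_le_tsum (hK : IsClosed (K : Set ℂ)) {ι : Type*} {a : ι → ZLat d → ℂ}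
    {s : ZLat d → ℂ} (hs : ∀ i, HasSum (fun n => a n i) (s i)) :
    B.bnorm K s ≤ ∑' n, B.bnorm K (a n) := by
  by_cases hfin : ∑' n, B.bnorm K (a n) = ⊤
  · simp [hfin]
  have h1 : ∀ n, a n ∈ B.carrier ∧ ∀ i, a n i ∈ K := fun n =>
    bnorm_ne_top_iff.1 (ENNReal.ne_top_of_tsum_ne_top hfin n)
  let b : ι → B.Elem := fun n => ⟨a n, (h1 n).1⟩
  have hb : ∀ n, B.bnorm K (a n) = ‖b n‖ₑ := fun n => by
    rw [bnorm_eq (h1 n).1 (h1 n).2, B.seqNorm_of_mem (h1 n).1, ← ofReal_norm]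
    rfl
  have hsum : Summable fun n => ‖b n‖ := by
    simp only [hb] at hfin
    exact NNReal.summable_coe.2 (ENNReal.tsum_coe_ne_top_iff_summable.1 hfin)
  have hb' : Summable b := hsum.of_norm
  -- Evaluations are continuous on $\mathfrak B$, so the norm-convergent sum has the prescribed
  -- pointwise values and $s$ is a member of $\mathfrak B$.
  have hev : ∀ i, HasSum (fun n => a n i) (Elem.toSeq B (∑' n, b n) i) := by
    intro i
    let φ : B.Elem →+ ℂ := (Pi.evalAddMonoidHom (fun _ : ZLat d => ℂ) i).comp
      (Elem.toSeq B : B.Elem →+ (ZLat d → ℂ))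
    have hφ : Continuous φ := AddMonoidHomClass.continuous_of_bound φ 1 fun x => by
      rw [one_mul]
      exact B.norm_apply_le x i
    exact hb'.hasSum.map φ hφ
  have hse : s = Elem.toSeq B (∑' n, b n) := funext fun i => (hs i).unique (hev i)
  have hsK : ∀ i, s i ∈ K := fun i =>
    hK.mem_of_tendsto (hs i) (Eventually.of_forall fun F => sum_mem fun n _ => (h1 n).2 i)
  have hsm : s ∈ B.carrier := by
    rw [hse]
    exact Elem.toSeq_mem _
  rw [bnorm_eq hsm hsK, B.seqNorm_of_mem hsm]
  have h3 : (⟨s, hsm⟩ : B.carrier) = (∑' n, b n : B.Elem) := Subtype.ext hse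
  rw [h3]
  change ENNReal.ofReal ‖∑' n, b n‖ ≤ _
  simp only [hb]
  have h2 : ∑' n, ‖b n‖ₑ = ENNReal.ofReal (∑' n, ‖b n‖) := by
    rw [ENNReal.ofReal_tsum_of_nonneg (fun _ => norm_nonneg _) hsum]
    simp only [ofReal_norm]
  rw [h2]
  exact ENNReal.ofReal_le_ofReal (norm_tsum_le_tsum_norm hsum)

theorem bnorm_add_le (a b : ZLat d → ℂ) :
    B.bnorm K (a + b) ≤ B.bnorm K a + B.bnorm K b := by
  rcases bnorm_cases (B := B) (K := K) a with h | ⟨h, hK, h'⟩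
  · simp [h]
  rcases bnorm_cases (B := B) (K := K) b with k | ⟨k, kK, k'⟩
  · simp [k]
  rw [h', k', bnorm_eq (add_mem h k) (fun i => add_mem (hK i) (kK i)),
    B.seqNorm_of_mem (add_mem h k), ← ENNReal.ofReal_add (B.nrm_nonneg _) (B.nrm_nonneg _)]
  exact ENNReal.ofReal_le_ofReal (map_add_le_add B.nrm ⟨a, h⟩ ⟨b, k⟩)

theorem bnorm_pow_le (a : ZLat d → ℂ) (n : ℕ) : B.bnorm K (a ^ n) ≤ B.bnorm K a ^ n := by
  induction n with
  | zero => simp [bnorm_one]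
  | succ n ih =>
    rw [pow_succ, pow_succ]
    exact (bnorm_mul_le _ _).trans (mul_le_mul' ih le_rfl)

end TransInvBanachAlg

/-! ### Infinite matrices as bounded operators on $\ell^1$, and commutators with a diagonal -/

theorem hasSum_of_eq {ι α : Type*} [AddCommMonoid α] [TopologicalSpace α] {f g : ι → α} {a : α}
    (h : HasSum f a) (e : ∀ i, f i = g i) : HasSum g a := (funext e : f = g) ▸ h

/-- Bounded operators on `ℓ¹(ℤ^d)`: a complete normed ring of infinite matrices. -/
abbrev LatOp (d : ℕ) : Type :=
  lp (fun _ : ZLat d => ℂ) 1 →L[ℂ] lp (fun _ : ZLat d => ℂ) 1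

namespace LatOp

variable {d : ℕ}

/-- The matrix of an operator. -/
noncomputable def ent (A : LatOp d) : LatMat d := fun i j => A (lp.single 1 j (1 : ℂ)) i

/-- The `i`-th coordinate as a continuous functional on `ℓ¹`. -/
noncomputable def coordL (i : ZLat d) : lp (fun _ : ZLat d => ℂ) 1 →L[ℂ] ℂ :=
  LinearMap.mkContinuous
    { toFun := fun f => f i
      map_add' := fun _ _ => rfl
      map_smul' := fun _ _ => rfl } 1
    fun f => by
      rw [one_mul]
      exact lp.norm_apply_le_norm one_ne_zero f i

theorem hasSum_norm_lp_one (f : lp (fun _ : ZLat d => ℂ) 1) : HasSum (fun i => ‖f i‖) ‖f‖ := by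
  simpa using lp.hasSum_norm (p := 1) (by simp) f

theorem hasSum_apply (A : LatOp d) (f : lp (fun _ : ZLat d => ℂ) 1) (i : ZLat d) :
    HasSum (fun k => A.ent i k * f k) (A f i) := by
  have h := ((coordL i).comp A).hasSum (lp.hasSum_single (p := 1) ENNReal.one_ne_top f)
  refine hasSum_of_eq h fun k => ?_
  have : lp.single 1 k (f k) = f k • (lp.single 1 k (1 : ℂ) : lp (fun _ : ZLat d => ℂ) 1) := by
    rw [← lp.single_smul]
    simp
  rw [this, map_smul, smul_eq_mul, mul_comm]
  rfl

theorem hasSum_ent_mul (A C : LatOp d) (i j : ZLat d) :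
    HasSum (fun k => A.ent i k * C.ent k j) ((A * C).ent i j) :=
  hasSum_apply A (C (lp.single 1 j (1 : ℂ))) i

theorem isProd (A C : LatOp d) : IsProd A.ent C.ent (A * C).ent := hasSum_ent_mul A C

theorem ent_injective : Function.Injective (ent : LatOp d → LatMat d) := by
  intro A C h
  ext f i
  have h1 := hasSum_apply A f i
  rw [h] at h1
  exact h1.unique (hasSum_apply C f i)

theorem ent_add (A C : LatOp d) : (A + C).ent = A.ent + C.ent := rfl

theorem ent_sub (A C : LatOp d) : (A - C).ent = A.ent - C.ent := rfl

theorem ent_neg (A : LatOp d) : (-A).ent = -A.ent := rfl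

theorem ent_zero : (0 : LatOp d).ent = 0 := rfl

theorem ent_one : (1 : LatOp d).ent = 1 := by
  ext i j
  change (lp.single 1 j (1 : ℂ) : lp (fun _ : ZLat d => ℂ) 1) i = (1 : LatMat d) i j
  rw [lp.single_apply, Matrix.one_apply]
  by_cases h : i = j
  · subst h; simp
  · simp [h]

theorem norm_ent_le (A : LatOp d) (i j : ZLat d) : ‖A.ent i j‖ ≤ ‖A‖ := by
  calc ‖A.ent i j‖ ≤ ‖A (lp.single 1 j (1 : ℂ))‖ := lp.norm_apply_le_norm one_ne_zero _ i
    _ ≤ ‖A‖ * ‖(lp.single 1 j (1 : ℂ) : lp (fun _ : ZLat d => ℂ) 1)‖ := A.le_opNorm _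
    _ = ‖A‖ := by rw [lp.norm_single one_pos, norm_one, mul_one]

theorem summable_norm_col (A : LatOp d) (j : ZLat d) : Summable fun i => ‖A.ent i j‖ :=
  (hasSum_norm_lp_one (A (lp.single 1 j (1 : ℂ)))).summable

theorem tsum_norm_col_le (A : LatOp d) (j : ZLat d) : ∑' i, ‖A.ent i j‖ ≤ ‖A‖ := by
  have : ∑' i, ‖A.ent i j‖ = ‖A (lp.single 1 j (1 : ℂ))‖ :=
    (hasSum_norm_lp_one (A (lp.single 1 j (1 : ℂ)))).tsum_eq
  rw [this]
  calc ‖A (lp.single 1 j (1 : ℂ))‖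
      ≤ ‖A‖ * ‖(lp.single 1 j (1 : ℂ) : lp (fun _ : ZLat d => ℂ) 1)‖ := A.le_opNorm _
    _ = ‖A‖ := by rw [lp.norm_single one_pos, norm_one, mul_one]

theorem tendsto_ent {ι : Type*} {l : Filter ι} {A : ι → LatOp d} {A' : LatOp d}
    (h : Tendsto A l (𝓝 A')) (i j : ZLat d) :
    Tendsto (fun n => (A n).ent i j) l (𝓝 (A'.ent i j)) := by
  exact ((((coordL i).comp (ContinuousLinearMap.apply ℂ _
    (lp.single 1 j (1 : ℂ)))).continuous).tendsto A').comp h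

theorem hasSum_ent {ι : Type*} {A : ι → LatOp d} {A' : LatOp d}
    (h : HasSum A A') (i j : ZLat d) : HasSum (fun n => (A n).ent i j) (A'.ent i j) := by
  have := h.mapL ((coordL i).comp (ContinuousLinearMap.apply ℂ _ (lp.single 1 j (1 : ℂ))))
  exact this

/-- A matrix with uniformly summable columns is the matrix of a bounded operator on `ℓ¹`. -/
theorem exists_ent_eq (M : LatMat d) (C : ℝ) (hs : ∀ j, Summable fun i => ‖M i j‖)
    (hC : ∀ j, ∑' i, ‖M i j‖ ≤ C) : ∃ A : LatOp d, A.ent = M ∧ ‖A‖ ≤ C := by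
  have hC0 : 0 ≤ C := (tsum_nonneg fun _ => norm_nonneg _).trans (hC 0)
  have hmem : ∀ j, Memℓp (fun i => M i j) 1 := fun j => by
    refine memℓp_gen ?_
    simpa using hs j
  let c : ZLat d → lp (fun _ : ZLat d => ℂ) 1 := fun j => ⟨fun i => M i j, hmem j⟩
  have hc : ∀ j, ‖c j‖ ≤ C := fun j => by
    rw [← (hasSum_norm_lp_one (c j)).tsum_eq]
    exact hC j
  have hn : ∀ f : lp (fun _ : ZLat d => ℂ) 1, Summable fun j => ‖f j‖ * C := fun f =>
    (hasSum_norm_lp_one f).summable.mul_right C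
  have hle : ∀ (f : lp (fun _ : ZLat d => ℂ) 1) (j), ‖f j • c j‖ ≤ ‖f j‖ * C := fun f j => by
    rw [norm_smul]
    exact mul_le_mul_of_nonneg_left (hc j) (norm_nonneg _)
  have hsm : ∀ f : lp (fun _ : ZLat d => ℂ) 1, Summable fun j => f j • c j := fun f =>
    Summable.of_norm_bounded (hn f) (hle f)
  let A : LatOp d := LinearMap.mkContinuous
    { toFun := fun f => ∑' j, f j • c j
      map_add' := fun f g => by
        rw [← (hsm f).tsum_add (hsm g)]
        refine tsum_congr fun j => ?_
        rw [lp.coeFn_add, Pi.add_apply, add_smul]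
      map_smul' := fun a f => by
        rw [RingHom.id_apply, ← (hsm f).tsum_const_smul]
        refine tsum_congr fun j => ?_
        rw [lp.coeFn_smul, Pi.smul_apply, smul_eq_mul, mul_smul] } C
    fun f => by
      calc ‖∑' j, f j • c j‖ ≤ ∑' j, ‖f j‖ * C := tsum_of_norm_bounded (hn f).hasSum (hle f)
        _ = C * ‖f‖ := by rw [tsum_mul_right, (hasSum_norm_lp_one f).tsum_eq, mul_comm]
  refine ⟨A, ?_, LinearMap.mkContinuous_norm_le _ hC0 _⟩
  ext i j
  have h1 : A (lp.single 1 j (1 : ℂ)) = c j := by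
    change ∑' k, (lp.single 1 j (1 : ℂ) : lp (fun _ : ZLat d => ℂ) 1) k • c k = c j
    rw [tsum_eq_single j]
    · rw [lp.single_apply_self, one_smul]
    · intro k hk
      rw [lp.single_apply_ne _ _ _ hk, zero_smul]
  change A (lp.single 1 j (1 : ℂ)) i = M i j
  rw [h1]

theorem ent_mul_diagonal {A D : LatOp d} {u : ZLat d → ℂ} (hD : D.ent = Matrix.diagonal u)
    (i j : ZLat d) : (A * D).ent i j = A.ent i j * u j := by
  refine (hasSum_ent_mul A D i j).unique ?_
  rw [hD]
  convert hasSum_single (f := fun k => A.ent i k * Matrix.diagonal u k j) j ?_ using 1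
  · simp
  · intro k hk
    simp [Matrix.diagonal_apply_ne _ hk]

theorem ent_diagonal_mul {A D : LatOp d} {u : ZLat d → ℂ} (hD : D.ent = Matrix.diagonal u)
    (i j : ZLat d) : (D * A).ent i j = u i * A.ent i j := by
  refine (hasSum_ent_mul D A i j).unique ?_
  rw [hD]
  convert hasSum_single (f := fun k => Matrix.diagonal u i k * A.ent k j) i ?_ using 1
  · simp
  · intro k hk
    simp [Matrix.diagonal_apply_ne _ hk.symm]

/-- `A'` is the commutator of the diagonal matrix with entries `p` and `A`. -/
def IsAd (p : ZLat d → ℂ) (A A' : LatOp d) : Prop :=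
  ∀ i j, (p i - p j) * A.ent i j = A'.ent i j

variable {p : ZLat d → ℂ}

theorem IsAd.add {A A' C C' : LatOp d} (h : IsAd p A A') (h' : IsAd p C C') :
    IsAd p (A + C) (A' + C') := fun i j => by
  rw [ent_add, ent_add, Matrix.add_apply, Matrix.add_apply, mul_add, h, h']

/-- The Leibniz rule, proved entrywise since multiplication by $p$ need not be a bounded operator.
-/
theorem IsAd.mul {A A' C C' : LatOp d} (h : IsAd p A A') (h' : IsAd p C C') :
    IsAd p (A * C) (A' * C + A * C') := fun i j => by
  refine ((hasSum_ent_mul A C i j).mul_left (p i - p j)).unique ?_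
  have := (hasSum_ent_mul A' C i j).add (hasSum_ent_mul A C' i j)
  refine hasSum_of_eq this fun k => ?_
  rw [← h, ← h']
  ring

theorem isAd_of_diagonal {D : LatOp d} {u : ZLat d → ℂ} (hD : D.ent = Matrix.diagonal u) :
    IsAd p D 0 := fun i j => by
  rw [hD, ent_zero]
  by_cases hij : i = j
  · simp [hij]
  · simp [hij]

theorem isAd_one : IsAd p (1 : LatOp d) 0 :=
  isAd_of_diagonal (u := 1) (by rw [ent_one, Matrix.diagonal_one'])

/-- The relation constrains each entry separately, hence is closed under norm limits even when $p$
is unbounded. -/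
theorem IsAd.of_tendsto {ι : Type*} {l : Filter ι} [l.NeBot] {A A' : ι → LatOp d} {a a' : LatOp d}
    (h : ∀ n, IsAd p (A n) (A' n)) (hA : Tendsto A l (𝓝 a)) (hA' : Tendsto A' l (𝓝 a')) :
    IsAd p a a' := fun i j => by
  refine tendsto_nhds_unique ((tendsto_ent hA i j).const_mul (p i - p j)) ?_
  refine (tendsto_ent hA' i j).congr fun n => ?_
  exact (h n i j).symm

/-- An intertwining relation, written with the commutator, gives the corresponding triple product
of matrices. -/
theorem isTripleProd_of_isAd {P Q D T : LatOp d}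
    (hPQ : P * Q = 1) (h : IsAd p Q (Q * D - T * Q)) :
    IsTripleProd P.ent (T.ent + Matrix.diagonal p) Q.ent (Matrix.diagonal p + D.ent) := by
  intro i j
  have hT : HasSum (fun kl : ZLat d × ZLat d => P.ent i kl.1 * T.ent kl.1 kl.2 * Q.ent kl.2 j)
      ((P * T * Q).ent i j) := by
    -- The entries of $P$ are bounded, the columns of $T$ uniformly summable and the $j$-th column
    -- of $Q$ summable. The pairs are swapped so that the inner sum runs down a column of $T$.
    have hsm : Summable fun lk : ZLat d × ZLat d =>
        ‖P.ent i lk.2 * T.ent lk.2 lk.1 * Q.ent lk.1 j‖ := by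
      have hle : ∀ lk : ZLat d × ZLat d, ‖P.ent i lk.2 * T.ent lk.2 lk.1 * Q.ent lk.1 j‖ ≤
          ‖P‖ * ‖T.ent lk.2 lk.1‖ * ‖Q.ent lk.1 j‖ := fun lk => by
        rw [norm_mul, norm_mul]
        gcongr
        exact norm_ent_le P _ _
      have hcol : ∀ l, Summable fun k => ‖P‖ * ‖T.ent k l‖ * ‖Q.ent l j‖ := fun l =>
        ((summable_norm_col T l).mul_left _).mul_right _
      refine Summable.of_nonneg_of_le (fun _ => norm_nonneg _) hle ?_
      refine (summable_prod_of_nonneg fun _ => by positivity).2 ⟨hcol, ?_⟩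
      refine Summable.of_nonneg_of_le (fun _ => tsum_nonneg fun _ => by positivity) (fun l => ?_)
        ((summable_norm_col Q j).mul_left (‖P‖ * ‖T‖))
      dsimp only
      rw [tsum_mul_right, tsum_mul_left]
      gcongr
      exact tsum_norm_col_le T l
    have hsm' := hsm.of_norm
    have e1 : HasSum (fun lk : ZLat d × ZLat d =>
        P.ent i lk.2 * T.ent lk.2 lk.1 * Q.ent lk.1 j) ((P * T * Q).ent i j) := by
      have h2 := hsm'.hasSum.prod_fiberwise
        (fun l => (hasSum_ent_mul P T i l).mul_right (Q.ent l j))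
      rw [(hasSum_ent_mul (P * T) Q i j).unique h2]
      exact hsm'.hasSum
    exact (Equiv.prodComm _ _).hasSum_iff.1 e1
  -- No bound on $p$ is available; the series converges because $p_kQ_{kj}=Q_{kj}p_j+(QD-TQ)_{kj}$.
  have hp : HasSum (fun k => P.ent i k * p k * Q.ent k j)
      ((P * Q).ent i j * p j + (P * (Q * D - T * Q)).ent i j) := by
    have h3 := ((hasSum_ent_mul P Q i j).mul_right (p j)).add
      (hasSum_ent_mul P (Q * D - T * Q) i j)
    refine hasSum_of_eq h3 fun k => ?_
    rw [← h k j]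
    ring
  have hp' : HasSum (fun kl : ZLat d × ZLat d =>
      P.ent i kl.1 * (Matrix.diagonal p : LatMat d) kl.1 kl.2 * Q.ent kl.2 j)
      ((P * Q).ent i j * p j + (P * (Q * D - T * Q)).ent i j) := by
    have hinj : Function.Injective fun k : ZLat d => (k, k) := fun a b hab => (Prod.ext_iff.1 hab).1
    refine (hinj.hasSum_iff ?_).1 (hasSum_of_eq hp fun k => ?_)
    · rintro ⟨k, l⟩ hkl
      have : k ≠ l := fun e => hkl ⟨k, by simp [e]⟩
      simp [this]
    · simp
  have hall := hT.add hp'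
  have e : (P * T * Q).ent i j + ((P * Q).ent i j * p j + (P * (Q * D - T * Q)).ent i j) =
      (Matrix.diagonal p + D.ent) i j := by
    have e1 : P * (Q * D - T * Q) = D - P * T * Q := by
      rw [mul_sub, ← mul_assoc, hPQ, one_mul, mul_assoc]
    rw [e1, hPQ, ent_one, ent_sub, Matrix.sub_apply, Matrix.add_apply]
    by_cases hij : i = j
    · subst hij; simp; ring
    · simp [hij]
  rw [e] at hall
  refine hasSum_of_eq hall fun kl => ?_
  simp only [Matrix.add_apply]
  ring

end LatOp

/-! ### Weighted norms of matrices: algebra property, $\ell^1$ boundedness, Sobolev norms -/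

theorem japanese_pos {d : ℕ} (k : ZLat d) : 0 < japanese k := one_pos.trans_le (le_max_left _ _)

theorem one_le_japanese {d : ℕ} (k : ZLat d) : 1 ≤ japanese k := le_max_left _ _

/-- A weight on the lattice whose weighted `ℓ²` space is a convolution algebra embedded in `ℓ¹`,
with constants one. -/
structure IsAlgWeight {d : ℕ} (w : ZLat d → ℝ) : Prop where
  pos : ∀ k, 0 < w k
  even : ∀ k, w (-k) = w k
  conv : ∀ k, ∑' l, (ENNReal.ofReal (w k) *
    ((ENNReal.ofReal (w l))⁻¹ * (ENNReal.ofReal (w (k - l)))⁻¹)) ^ 2 ≤ 1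
  sum : ∑' l, ((ENNReal.ofReal (w l))⁻¹) ^ 2 ≤ 1

theorem IsAlgWeight.one_le {d : ℕ} {w : ZLat d → ℝ} (hw : IsAlgWeight w) (k : ZLat d) :
    1 ≤ ENNReal.ofReal (w k) := by
  have h := (ENNReal.le_tsum k).trans hw.sum
  rw [pow_le_one_iff two_ne_zero, ENNReal.inv_le_one] at h
  exact h

namespace TransInvBanachAlg

variable {d : ℕ} (B : TransInvBanachAlg d) (K : Subfield ℂ)

/-- The weighted `ℓ²` norm of the diagonals of a matrix. -/
noncomputable def wnorm (w : ZLat d → ℝ) (M : LatMat d) : ℝ≥0∞ :=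
  ellTwo fun k => B.bnorm K (kDiag M k) * ENNReal.ofReal (w k)

variable {B K}

theorem wnorm_le_mul_wnorm {w w' : ZLat d → ℝ} {M M' : LatMat d} {c : ℝ≥0∞}
    (h : ∀ k, B.bnorm K (kDiag M k) * ENNReal.ofReal (w k) ≤
      c * (B.bnorm K (kDiag M' k) * ENNReal.ofReal (w' k))) :
    B.wnorm K w M ≤ c * B.wnorm K w' M' := by
  unfold wnorm
  rw [← ellTwo_const_mul]
  exact ellTwo_mono h

theorem wnorm_le_of_weight_le {w w' : ZLat d → ℝ} {c : ℝ} (hc : 0 ≤ c)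
    (h : ∀ k, w k ≤ c * w' k) (M : LatMat d) :
    B.wnorm K w M ≤ ENNReal.ofReal c * B.wnorm K w' M := by
  refine wnorm_le_mul_wnorm fun k => ?_
  rw [mul_left_comm, ← ENNReal.ofReal_mul hc]
  exact mul_le_mul' le_rfl (ENNReal.ofReal_le_ofReal (h k))

theorem wnorm_mono {w w' : ZLat d → ℝ} (h : ∀ k, w k ≤ w' k) (M : LatMat d) :
    B.wnorm K w M ≤ B.wnorm K w' M := by
  simpa using wnorm_le_of_weight_le (B := B) (K := K) zero_le_one (by simpa using h) M

theorem wnorm_add_le (w : ZLat d → ℝ) (M M' : LatMat d) :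
    B.wnorm K w (M + M') ≤ B.wnorm K w M + B.wnorm K w M' := by
  refine le_trans (ellTwo_mono fun k => ?_) (ellTwo_add_le _ _)
  rw [← add_mul]
  exact mul_le_mul' (bnorm_add_le (kDiag M k) (kDiag M' k)) le_rfl

theorem wnorm_neg (w : ZLat d → ℝ) (M : LatMat d) : B.wnorm K w (-M) = B.wnorm K w M := by
  unfold wnorm
  congr 1
  funext k
  have : kDiag (-M) k = -kDiag M k := rfl
  rw [this, bnorm_neg]

theorem wnorm_sub_le (w : ZLat d → ℝ) (M M' : LatMat d) :
    B.wnorm K w (M - M') ≤ B.wnorm K w M + B.wnorm K w M' := by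
  rw [sub_eq_add_neg, ← wnorm_neg w M']
  exact wnorm_add_le w M (-M')

/-- Entrywise convergence is enough, so completeness of the weighted spaces never has to be
established: limits are taken among operators on $\ell^1$ and estimated here. -/
theorem wnorm_le_tsum (hK : IsClosed (K : Set ℂ)) (w : ZLat d → ℝ) {ι : Type*}
    {M : ι → LatMat d} {S : LatMat d} (hS : ∀ i j, HasSum (fun n => M n i j) (S i j)) :
    B.wnorm K w S ≤ ∑' n, B.wnorm K w (M n) := by
  refine le_trans (ellTwo_mono fun k => ?_) (ellTwo_tsum_le _)
  rw [ENNReal.tsum_mul_right]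
  exact mul_le_mul' (bnorm_le_tsum hK fun i => hS i (i - k)) le_rfl

theorem kDiag_diagonal_zero (u : ZLat d → ℂ) : kDiag (Matrix.diagonal u) 0 = u := by
  funext i
  simp [kDiag]

theorem kDiag_diagonal_ne (u : ZLat d → ℂ) {k : ZLat d} (hk : k ≠ 0) :
    kDiag (Matrix.diagonal u) k = 0 := by
  funext i
  exact Matrix.diagonal_apply_ne _ fun h => hk (sub_eq_self.1 h.symm)

theorem wnorm_diagonal (w : ZLat d → ℝ) (u : ZLat d → ℂ) :
    B.wnorm K w (Matrix.diagonal u) = B.bnorm K u * ENNReal.ofReal (w 0) := by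
  apply (ENNReal.pow_right_strictMono two_ne_zero).injective
  dsimp only
  rw [wnorm, ellTwo_sq, tsum_eq_single 0, kDiag_diagonal_zero]
  intro k hk
  rw [kDiag_diagonal_ne u hk, bnorm_zero, zero_mul, zero_pow two_ne_zero]

theorem wnorm_one (w : ZLat d → ℝ) : B.wnorm K w 1 = ENNReal.ofReal (w 0) := by
  rw [← Matrix.diagonal_one', wnorm_diagonal]
  erw [bnorm_one]
  rw [one_mul]

theorem bnorm_diag_mul_le (w : ZLat d → ℝ) (M : LatMat d) :
    B.bnorm K (fun i => M i i) * ENNReal.ofReal (w 0) ≤ B.wnorm K w M := by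
  refine le_trans (le_of_eq ?_)
    (le_ellTwo (fun k => B.bnorm K (kDiag M k) * ENNReal.ofReal (w k)) 0)
  have : kDiag M 0 = fun i => M i i := by
    funext i
    simp [kDiag]
  rw [this]

theorem wnorm_diag_le (w : ZLat d → ℝ) (M : LatMat d) :
    B.wnorm K w (Matrix.diagonal fun i => M i i) ≤ B.wnorm K w M := by
  rw [wnorm_diagonal]
  exact bnorm_diag_mul_le w M

theorem bnorm_diag_le {w : ZLat d → ℝ} (hw : IsAlgWeight w) (M : LatMat d) :
    B.bnorm K (fun i => M i i) ≤ B.wnorm K w M :=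
  (le_mul_of_one_le_right' (hw.one_le 0)).trans (bnorm_diag_mul_le w M)

/-- The diagonal of $M^t$ at $-k$ is a translate of $M_k$, and translations are isometric. -/
theorem wnorm_transpose {w : ZLat d → ℝ} (hw : ∀ k, w (-k) = w k) (M : LatMat d) :
    B.wnorm K w Mᵀ = B.wnorm K w M := by
  unfold wnorm
  rw [← ellTwo_equiv (Equiv.neg (ZLat d))]
  congr 1
  funext k
  have : kDiag Mᵀ (-k) = latShift (-k) (kDiag M k) := by
    funext i
    simp [kDiag, latShift]
  simp only [Equiv.neg_apply]
  rw [this, bnorm_shift, hw]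

/-- The diagonals of a product form a twisted convolution, $(AC)_k=\sum_l A_l\,\sigma_l C_{k-l}$. As
$\sigma_l$ is isometric, their norms are dominated by an ordinary convolution. -/
theorem wnorm_mul_le (hK : IsClosed (K : Set ℂ)) {w : ZLat d → ℝ} (hw : IsAlgWeight w)
    (A C : LatOp d) : B.wnorm K w (A * C).ent ≤ B.wnorm K w A.ent * B.wnorm K w C.ent := by
  refine le_trans (ellTwo_mono fun k => mul_le_mul' ?_ le_rfl)
    (ellTwo_conv_le (fun k => ENNReal.ofReal (w k)) (fun k => B.bnorm K (kDiag A.ent k))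
      (fun k => B.bnorm K (kDiag C.ent k)) (fun k => (ENNReal.ofReal_pos.2 (hw.pos k)).ne')
      (fun k => ENNReal.ofReal_ne_top) hw.conv)
  have h : ∀ i, HasSum
      (fun l => (kDiag A.ent l * latShift l (kDiag C.ent (k - l))) i) (kDiag (A * C).ent k i) := by
    intro i
    refine hasSum_of_eq ((Equiv.subLeft i).hasSum_iff.2 (A.hasSum_ent_mul C i (i - k))) fun l => ?_
    simp [kDiag, latShift]
  refine (bnorm_le_tsum hK h).trans (ENNReal.tsum_le_tsum fun l => ?_)
  refine (bnorm_mul_le _ _).trans ?_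
  rw [bnorm_shift]

/-- Each column meets every diagonal once, so its sum is at most $\sum_k\|M_k\|$; Cauchy–Schwarz
against $\sum_k w(k)^{-2}\le1$ finishes. -/
theorem tsum_enorm_col_le {w : ZLat d → ℝ} (hw : IsAlgWeight w) (M : LatMat d) (j : ZLat d) :
    ∑' i, ‖M i j‖ₑ ≤ B.wnorm K w M := by
  have h1 : ∑' i, ‖M i j‖ₑ ≤ ∑' k, B.bnorm K (kDiag M k) := by
    rw [← (Equiv.addLeft j).tsum_eq]
    refine ENNReal.tsum_le_tsum fun k => ?_
    have := enorm_apply_le_bnorm (B := B) (K := K) (kDiag M k) (j + k)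
    simpa [kDiag] using this
  refine h1.trans ?_
  have h2 : ∑' k, B.bnorm K (kDiag M k) = ∑' k,
      (B.bnorm K (kDiag M k) * ENNReal.ofReal (w k)) * (ENNReal.ofReal (w k))⁻¹ := by
    refine tsum_congr fun k => ?_
    rw [mul_assoc, ENNReal.mul_inv_cancel (ENNReal.ofReal_pos.2 (hw.pos k)).ne'
      ENNReal.ofReal_ne_top, mul_one]
  rw [h2, ← ENNReal.sq_le_sq_iff]
  refine (ENNReal.sq_tsum_mul_le _ _).trans ?_
  rw [wnorm, ellTwo_sq]
  exact (mul_le_mul' le_rfl hw.sum).trans (mul_one _).le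

/-- Matrices of finite weighted norm are bounded operators on `ℓ¹`. -/
theorem exists_ent_eq_of_wnorm {w : ZLat d → ℝ} (hw : IsAlgWeight w) {M : LatMat d}
    (hM : B.wnorm K w M ≠ ⊤) : ∃ A : LatOp d, A.ent = M ∧ ‖A‖ₑ ≤ B.wnorm K w M := by
  have hfin : ∀ j, ∑' i, ‖M i j‖ₑ ≠ ⊤ := fun j =>
    ne_top_of_le_ne_top hM (tsum_enorm_col_le hw M j)
  have hs : ∀ j, Summable fun i => ‖M i j‖ := fun j =>
    NNReal.summable_coe.2 (ENNReal.tsum_coe_ne_top_iff_summable.1 (hfin j))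
  obtain ⟨A, hA, hAn⟩ := LatOp.exists_ent_eq M (B.wnorm K w M).toReal hs fun j => by
    rw [← ENNReal.ofReal_le_iff_le_toReal hM, ENNReal.ofReal_tsum_of_nonneg
      (fun _ => norm_nonneg _) (hs j)]
    simpa only [ofReal_norm] using tsum_enorm_col_le hw M j
  refine ⟨A, hA, ?_⟩
  rw [← ofReal_norm, ENNReal.ofReal_le_iff_le_toReal hM]
  exact hAn

theorem enorm_le_wnorm {w : ZLat d → ℝ} (hw : IsAlgWeight w) (A : LatOp d) :
    ‖A‖ₑ ≤ B.wnorm K w A.ent := by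
  by_cases hM : B.wnorm K w A.ent = ⊤
  · simp [hM]
  obtain ⟨A', h1, h2⟩ := exists_ent_eq_of_wnorm hw hM
  rwa [LatOp.ent_injective h1] at h2

theorem norm_le_of_wnorm_le {w : ZLat d → ℝ} (hw : IsAlgWeight w) {A : LatOp d} {x : ℝ}
    (hx : 0 ≤ x) (h : B.wnorm K w A.ent ≤ ENNReal.ofReal x) : ‖A‖ ≤ x := by
  have := (enorm_le_wnorm hw A).trans h
  rwa [← ofReal_norm, ENNReal.ofReal_le_ofReal_iff hx] at this

/-- Neumann series in the weighted algebra. -/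
theorem exists_inverse_one_add (hK : IsClosed (K : Set ℂ)) {w : ZLat d → ℝ} (hw : IsAlgWeight w)
    {W : LatOp d} {x : ℝ} (hx : 0 ≤ x) (hx2 : x ≤ 1 / 2)
    (h : B.wnorm K w W.ent ≤ ENNReal.ofReal x) :
    ∃ V : LatOp d, (1 + V) * (1 + W) = 1 ∧ (1 + W) * (1 + V) = 1 ∧
      B.wnorm K w V.ent ≤ ENNReal.ofReal (2 * x) := by
  have hpow : ∀ n : ℕ, B.wnorm K w ((-W) ^ (n + 1)).ent ≤ ENNReal.ofReal (x ^ (n + 1)) := by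
    intro n
    induction n with
    | zero => simpa [LatOp.ent_neg, wnorm_neg] using h
    | succ n ih =>
      rw [pow_succ, pow_succ x, ENNReal.ofReal_mul (by positivity)]
      refine (wnorm_mul_le hK hw _ _).trans (mul_le_mul' ih ?_)
      rwa [LatOp.ent_neg, wnorm_neg]
  have hx1 : x < 1 := by linarith
  have hW : ‖-W‖ < 1 := by
    rw [norm_neg]
    exact (norm_le_of_wnorm_le hw hx h).trans_lt hx1
  have hg := summable_geometric_of_norm_lt_one (x := -W) hW
  have hg1 : Summable fun n : ℕ => (-W) ^ (n + 1) := (summable_nat_add_iff 1).2 hg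
  have hV : 1 + ∑' n : ℕ, (-W) ^ (n + 1) = ∑' n : ℕ, (-W) ^ n := by
    rw [hg.tsum_eq_zero_add, pow_zero]
  refine ⟨∑' n : ℕ, (-W) ^ (n + 1), ?_, ?_, ?_⟩
  · rw [hV]
    have := geom_series_mul_neg (-W) hW
    rwa [sub_neg_eq_add] at this
  · rw [hV]
    have := mul_neg_geom_series (-W) hW
    rwa [sub_neg_eq_add] at this
  · refine (wnorm_le_tsum hK w (LatOp.hasSum_ent hg1.hasSum)).trans ?_
    refine (ENNReal.tsum_le_tsum hpow).trans ?_
    have hs : HasSum (fun n : ℕ => x ^ (n + 1)) (x * (1 - x)⁻¹) := by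
      simpa only [pow_succ'] using (hasSum_geometric_of_lt_one hx hx1).mul_left x
    rw [← ENNReal.ofReal_tsum_of_nonneg (fun n => by positivity) hs.summable, hs.tsum_eq]
    refine ENNReal.ofReal_le_ofReal ?_
    have : (1 - x)⁻¹ ≤ 2 := by
      rw [inv_le_comm₀ (by linarith) two_pos]
      linarith
    nlinarith

/-- Bridge to the Sobolev norms of the statement: finiteness of the extended norm already contains
both membership in $\mathfrak B$ and summability. -/
theorem memSob_of_wnorm {s : ℝ} {M : LatMat d}
    (h : B.wnorm K (fun k => japanese k ^ s) M ≠ ⊤) :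
    B.MemSob s M ∧ B.wnorm K (fun k => japanese k ^ s) M = ENNReal.ofReal (B.sobNorm s M) := by
  have hk : ∀ k, B.bnorm K (kDiag M k) ≠ ⊤ := by
    intro k hk
    have h1 := le_ellTwo (fun k => B.bnorm K (kDiag M k) * ENNReal.ofReal (japanese k ^ s)) k
    rw [hk, ENNReal.top_mul (ENNReal.ofReal_pos.2 (Real.rpow_pos_of_pos (japanese_pos k) s)).ne',
      top_le_iff] at h1
    exact h h1
  have hk' := fun k => bnorm_ne_top_iff.1 (hk k)
  have hterm : ∀ k, (B.bnorm K (kDiag M k) * ENNReal.ofReal (japanese k ^ s)) ^ 2 =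
      ENNReal.ofReal (B.seqNorm (kDiag M k) ^ 2 * japanese k ^ (2 * s)) := by
    intro k
    rw [bnorm_eq (hk' k).1 (hk' k).2, ← ENNReal.ofReal_mul (B.seqNorm_nonneg _),
      ← ENNReal.ofReal_pow (mul_nonneg (B.seqNorm_nonneg _)
        (Real.rpow_nonneg (japanese_pos k).le s)), mul_pow, mul_comm 2 s,
      Real.rpow_mul (japanese_pos k).le, Real.rpow_two]
  have hnn : ∀ k, 0 ≤ B.seqNorm (kDiag M k) ^ 2 * japanese k ^ (2 * s) := fun k =>
    mul_nonneg (sq_nonneg _) (Real.rpow_nonneg (japanese_pos k).le _)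
  have hsq : B.wnorm K (fun k => japanese k ^ s) M ^ 2 =
      ∑' k, ENNReal.ofReal (B.seqNorm (kDiag M k) ^ 2 * japanese k ^ (2 * s)) := by
    rw [wnorm, ellTwo_sq]
    exact tsum_congr hterm
  have hfin : ∑' k, ENNReal.ofReal (B.seqNorm (kDiag M k) ^ 2 * japanese k ^ (2 * s)) ≠ ⊤ := by
    rw [← hsq]
    exact ENNReal.pow_ne_top h
  have hsum : Summable fun k => B.seqNorm (kDiag M k) ^ 2 * japanese k ^ (2 * s) := by
    have := ENNReal.summable_toReal hfin
    exact hasSum_of_eq this.hasSum (fun k => ENNReal.toReal_ofReal (hnn k)) |>.summable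
  refine ⟨⟨fun k => (hk' k).1, hsum⟩, ?_⟩
  apply (ENNReal.pow_right_strictMono two_ne_zero).injective
  dsimp only
  rw [hsq, sobNorm, ← ENNReal.ofReal_pow (Real.sqrt_nonneg _), Real.sq_sqrt (tsum_nonneg hnn),
    ENNReal.ofReal_tsum_of_nonneg hnn hsum]

theorem wnorm_of_memSob {s : ℝ} {M : LatMat d} (h : B.MemSob s M) (hK : ∀ i j, M i j ∈ K) :
    B.wnorm K (fun k => japanese k ^ s) M = ENNReal.ofReal (B.sobNorm s M) := by
  refine (memSob_of_wnorm ?_).2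
  have hnn : ∀ k, 0 ≤ B.seqNorm (kDiag M k) ^ 2 * japanese k ^ (2 * s) := fun k =>
    mul_nonneg (sq_nonneg _) (Real.rpow_nonneg (japanese_pos k).le _)
  have hterm : ∀ k, (B.bnorm K (kDiag M k) * ENNReal.ofReal (japanese k ^ s)) ^ 2 =
      ENNReal.ofReal (B.seqNorm (kDiag M k) ^ 2 * japanese k ^ (2 * s)) := by
    intro k
    rw [bnorm_eq (h.1 k) (fun i => hK _ _), ← ENNReal.ofReal_mul (B.seqNorm_nonneg _),
      ← ENNReal.ofReal_pow (mul_nonneg (B.seqNorm_nonneg _)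
        (Real.rpow_nonneg (japanese_pos k).le s)), mul_pow, mul_comm 2 s,
      Real.rpow_mul (japanese_pos k).le, Real.rpow_two]
  intro htop
  have hsq : B.wnorm K (fun k => japanese k ^ s) M ^ 2 =
      ENNReal.ofReal (∑' k, B.seqNorm (kDiag M k) ^ 2 * japanese k ^ (2 * s)) := by
    rw [wnorm, ellTwo_sq, ENNReal.ofReal_tsum_of_nonneg hnn h.2]
    exact tsum_congr hterm
  rw [htop] at hsq
  simp at hsq

theorem sobNorm_nonneg (s : ℝ) (M : LatMat d) : 0 ≤ B.sobNorm s M := Real.sqrt_nonneg _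

theorem memSob_and_sobNorm_le {s : ℝ} {M : LatMat d} {x : ℝ} (hx : 0 ≤ x)
    (h : B.wnorm K (fun k => japanese k ^ s) M ≤ ENNReal.ofReal x) :
    B.MemSob s M ∧ B.sobNorm s M ≤ x := by
  have h1 := memSob_of_wnorm (ne_top_of_le_ne_top ENNReal.ofReal_ne_top h)
  refine ⟨h1.1, ?_⟩
  rwa [h1.2, ENNReal.ofReal_le_ofReal_iff hx] at h

end TransInvBanachAlg

/-! ### Polynomial and exponential weights on the lattice -/

section Weights

variable {d : ℕ}

theorem summable_norm_rpow_int_lattice {r : ℝ} (hr : r < -(d : ℝ)) :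
    Summable fun k : ZLat d => ‖k‖ ^ r := by
  let b := Pi.basisFun ℝ (Fin d)
  let L : Submodule ℤ (Fin d → ℝ) := Submodule.span ℤ (Set.range b)
  have hmem : ∀ k : ZLat d, (fun v => (k v : ℝ)) ∈ L := fun k => by
    rw [b.mem_span_iff_repr_mem ℤ]
    exact fun v => ⟨k v, by simp [b]⟩
  have hrank : Module.finrank ℤ L = d := by
    rw [ZLattice.rank ℝ L]
    simp
  have h := ZLattice.summable_norm_rpow L r (by rw [hrank]; exact hr)
  have hinj : Function.Injective fun k : ZLat d => (⟨fun v => (k v : ℝ), hmem k⟩ : L) := by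
    intro k l hkl
    funext v
    have : ((k v : ℤ) : ℝ) = l v := congrFun (congrArg Subtype.val hkl) v
    exact_mod_cast this
  refine (h.comp_injective hinj).congr fun k => ?_
  change ‖fun v => (k v : ℝ)‖ ^ r = ‖k‖ ^ r
  congr 1

theorem summable_japanese_rpow {r : ℝ} (hr : r < -(d : ℝ)) :
    Summable fun k : ZLat d => japanese k ^ r := by
  refine Summable.of_norm_bounded_eventually (summable_norm_rpow_int_lattice hr) ?_
  filter_upwards [(Set.finite_singleton (0 : ZLat d)).compl_mem_cofinite] with k hk
  have hk0 : 0 < ‖k‖ := norm_pos_iff.2 hk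
  rw [Real.norm_of_nonneg (Real.rpow_nonneg (japanese_pos k).le _)]
  exact Real.rpow_le_rpow_of_nonpos hk0 (le_max_right _ _)
    (hr.le.trans (neg_nonpos.2 (Nat.cast_nonneg d)))

/-- A bound for `∑ ⟨k⟩ ^ (-2 α₀)` that is uniform in the admissible dimensions. -/
theorem exists_tsum_japanese_le (α₀ : ℝ) : ∃ Z : ℝ, 1 ≤ Z ∧ ∀ d : ℕ, (d : ℝ) / 2 < α₀ →
    ∑' k : ZLat d, ENNReal.ofReal (japanese k ^ (-(2 * α₀))) ≤ ENNReal.ofReal Z := by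
  let f : ℕ → ℝ := fun d => ∑' k : ZLat d, japanese k ^ (-(2 * α₀))
  have hf : ∀ d, 0 ≤ f d := fun d =>
    tsum_nonneg fun k => Real.rpow_nonneg (japanese_pos k).le _
  -- Only finitely many dimensions satisfy $d<2\alpha_0$, so one sum dominates all of them and the
  -- final constant does not depend on $d$.
  refine ⟨1 + ∑ d ∈ Finset.range ⌈2 * α₀⌉₊, f d, ?_, fun d hd => ?_⟩
  · linarith [Finset.sum_nonneg fun d (_ : d ∈ Finset.range ⌈2 * α₀⌉₊) => hf d]
  · rw [← ENNReal.ofReal_tsum_of_nonneg (fun k => Real.rpow_nonneg (japanese_pos k).le _)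
      (summable_japanese_rpow (by linarith))]
    refine ENNReal.ofReal_le_ofReal ?_
    have hmem : d ∈ Finset.range ⌈2 * α₀⌉₊ := by
      rw [Finset.mem_range, Nat.lt_ceil]
      linarith
    have := Finset.single_le_sum (f := f) (fun d _ => hf d) hmem
    change f d ≤ _
    linarith

/-- The weight `c ⟨k⟩ ^ s exp (ρ |k|)`. -/
noncomputable def expWeight (c s ρ : ℝ) (k : ZLat d) : ℝ :=
  c * japanese k ^ s * Real.exp (ρ * ‖k‖)

theorem expWeight_zero (c s ρ : ℝ) : expWeight c s ρ (0 : ZLat d) = c := by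
  simp [expWeight, japanese]

theorem japanese_neg (k : ZLat d) : japanese (-k) = japanese k := by simp [japanese]

theorem japanese_rpow_le {s : ℝ} (hs : 0 ≤ s) (k l : ZLat d) :
    japanese k ^ s ≤ 2 ^ s * (japanese l ^ s + japanese (k - l) ^ s) := by
  have hl := japanese_pos l
  have hkl := japanese_pos (k - l)
  have h1 : japanese k ≤ 2 * max (japanese l) (japanese (k - l)) := by
    refine max_le ?_ ?_
    · linarith [one_le_japanese l, le_max_left (japanese l) (japanese (k - l))]
    · calc ‖k‖ = ‖l + (k - l)‖ := by rw [add_sub_cancel]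
        _ ≤ ‖l‖ + ‖k - l‖ := norm_add_le _ _
        _ ≤ japanese l + japanese (k - l) := add_le_add (le_max_right _ _) (le_max_right _ _)
        _ ≤ _ := by
          linarith [le_max_left (japanese l) (japanese (k - l)),
            le_max_right (japanese l) (japanese (k - l))]
  refine (Real.rpow_le_rpow (japanese_pos k).le h1 hs).trans ?_
  rw [Real.mul_rpow two_pos.le (hl.le.trans (le_max_left _ _))]
  refine mul_le_mul_of_nonneg_left ?_ (by positivity)
  rcases max_cases (japanese l) (japanese (k - l)) with h | h
  · rw [h.1]
    linarith [Real.rpow_nonneg hkl.le s]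
  · rw [h.1]
    linarith [Real.rpow_nonneg hl.le s]

/-- The exponential factor is submultiplicative, and $\langle k\rangle^s\le2^s(\langle
l\rangle^s+\langle k-l\rangle^s)$ bounds the kernel by $(2Z)^{-1}(\langle l\rangle^{-s}+\langle
k-l\rangle^{-s})$; this is why $c=2^{s+1}Z$. The square sums over $l$ to at most one since $s\ge
s_0$. -/
theorem isAlgWeight_expWeight {Z s₀ s c ρ : ℝ} (hZ : 1 ≤ Z)
    (hZs : ∑' k : ZLat d, ENNReal.ofReal (japanese k ^ (-(2 * s₀))) ≤ ENNReal.ofReal Z)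
    (hs₀ : 0 ≤ s₀) (hs : s₀ ≤ s) (hc : c = 2 ^ (s + 1) * Z) (hρ : 0 ≤ ρ) :
    IsAlgWeight (expWeight c s ρ : ZLat d → ℝ) := by
  have hs' : 0 ≤ s := hs₀.trans hs
  have hZ0 : 0 < Z := by linarith
  have h2s : 1 ≤ (2 : ℝ) ^ s := Real.one_le_rpow one_le_two hs'
  have hce : c = 2 * 2 ^ s * Z := by
    rw [hc, Real.rpow_add two_pos, Real.rpow_one]
    ring
  have hc0 : 0 < c := by rw [hce]; positivity
  have hcZ : Z ≤ c := by
    rw [hce]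
    nlinarith
  have hpos : ∀ k : ZLat d, 0 < expWeight c s ρ k := fun k =>
    mul_pos (mul_pos hc0 (Real.rpow_pos_of_pos (japanese_pos k) s)) (Real.exp_pos _)
  have hjs : ∀ k : ZLat d, ((japanese k ^ s)⁻¹) ^ 2 ≤ japanese k ^ (-(2 * s₀)) := fun k => by
    rw [← Real.rpow_neg (japanese_pos k).le, ← Real.rpow_natCast, ← Real.rpow_mul
      (japanese_pos k).le]
    refine Real.rpow_le_rpow_of_exponent_le (one_le_japanese k) ?_
    push_cast
    linarith
  refine ⟨hpos, fun k => by simp [expWeight, japanese_neg], fun k => ?_, ?_⟩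
  · have key : ∀ l : ZLat d, (expWeight c s ρ k *
        ((expWeight c s ρ l)⁻¹ * (expWeight c s ρ (k - l))⁻¹)) ^ 2 ≤
        (2 * Z)⁻¹ * (japanese l ^ (-(2 * s₀)) + japanese (k - l) ^ (-(2 * s₀))) := by
      intro l
      have hl := Real.rpow_pos_of_pos (japanese_pos l) s
      have hkl := Real.rpow_pos_of_pos (japanese_pos (k - l)) s
      have hexp : Real.exp (ρ * ‖k‖) ≤ Real.exp (ρ * ‖l‖) * Real.exp (ρ * ‖k - l‖) := by
        rw [← Real.exp_add, ← mul_add]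
        refine Real.exp_le_exp.2 (mul_le_mul_of_nonneg_left ?_ hρ)
        calc ‖k‖ = ‖l + (k - l)‖ := by rw [add_sub_cancel]
          _ ≤ _ := norm_add_le _ _
      have h1 : expWeight c s ρ k * ((expWeight c s ρ l)⁻¹ * (expWeight c s ρ (k - l))⁻¹) ≤
          (2 * Z)⁻¹ * ((japanese l ^ s)⁻¹ + (japanese (k - l) ^ s)⁻¹) := by
        rw [← mul_inv, ← div_eq_mul_inv, div_le_iff₀ (mul_pos (hpos l) (hpos (k - l)))]
        have e : (2 * Z)⁻¹ * ((japanese l ^ s)⁻¹ + (japanese (k - l) ^ s)⁻¹) *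
            (expWeight c s ρ l * expWeight c s ρ (k - l)) =
            c * (2 ^ s * (japanese l ^ s + japanese (k - l) ^ s)) *
              (Real.exp (ρ * ‖l‖) * Real.exp (ρ * ‖k - l‖)) := by
          simp only [expWeight, hce]
          field_simp
          ring
        rw [e, expWeight]
        exact mul_le_mul (mul_le_mul_of_nonneg_left (japanese_rpow_le hs' k l) hc0.le) hexp
          (Real.exp_pos _).le (by positivity)
      have h0 : 0 ≤ expWeight c s ρ k *
          ((expWeight c s ρ l)⁻¹ * (expWeight c s ρ (k - l))⁻¹) :=
        mul_nonneg (hpos k).le (mul_nonneg (inv_nonneg.2 (hpos l).le) (inv_nonneg.2 (hpos _).le))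
      refine (pow_le_pow_left₀ h0 h1 2).trans ?_
      have hinv : (2 * Z)⁻¹ ≤ 1 / 2 := by
        rw [inv_le_comm₀ (by linarith) (by norm_num)]
        linarith
      have hinv0 : 0 ≤ (2 * Z)⁻¹ := by positivity
      have ha := hjs l
      have hb := hjs (k - l)
      set a := (japanese l ^ s)⁻¹
      set b := (japanese (k - l) ^ s)⁻¹
      calc ((2 * Z)⁻¹ * (a + b)) ^ 2 = (2 * Z)⁻¹ * ((2 * Z)⁻¹ * (a + b) ^ 2) := by ring
        _ ≤ (2 * Z)⁻¹ * (1 / 2 * (a + b) ^ 2) := by gcongr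
        _ ≤ (2 * Z)⁻¹ * (a ^ 2 + b ^ 2) := by
          gcongr
          nlinarith [sq_nonneg (a - b)]
        _ ≤ _ := by gcongr
    have hterm : ∀ l : ZLat d, (ENNReal.ofReal (expWeight c s ρ k) *
        ((ENNReal.ofReal (expWeight c s ρ l))⁻¹ *
          (ENNReal.ofReal (expWeight c s ρ (k - l)))⁻¹)) ^ 2 ≤
        ENNReal.ofReal (2 * Z)⁻¹ * (ENNReal.ofReal (japanese l ^ (-(2 * s₀))) +
          ENNReal.ofReal (japanese (k - l) ^ (-(2 * s₀)))) := by
      intro l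
      rw [← ENNReal.ofReal_inv_of_pos (hpos l), ← ENNReal.ofReal_inv_of_pos (hpos (k - l)),
        ← ENNReal.ofReal_mul (inv_nonneg.2 (hpos l).le), ← ENNReal.ofReal_mul (hpos k).le,
        ← ENNReal.ofReal_pow (mul_nonneg (hpos k).le
          (mul_nonneg (inv_nonneg.2 (hpos l).le) (inv_nonneg.2 (hpos _).le))),
        ← ENNReal.ofReal_add (Real.rpow_nonneg (japanese_pos _).le _)
          (Real.rpow_nonneg (japanese_pos _).le _), ← ENNReal.ofReal_mul (by positivity)]
      exact ENNReal.ofReal_le_ofReal (key l)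
    refine (ENNReal.tsum_le_tsum hterm).trans ?_
    rw [ENNReal.tsum_mul_left, ENNReal.tsum_add]
    have hre : ∑' l : ZLat d, ENNReal.ofReal (japanese (k - l) ^ (-(2 * s₀))) =
        ∑' l : ZLat d, ENNReal.ofReal (japanese l ^ (-(2 * s₀))) :=
      (Equiv.subLeft k).tsum_eq fun l => ENNReal.ofReal (japanese l ^ (-(2 * s₀)))
    rw [hre]
    refine (mul_le_mul' le_rfl (add_le_add hZs hZs)).trans ?_
    rw [← ENNReal.ofReal_add hZ0.le hZ0.le, ← ENNReal.ofReal_mul (by positivity), ← two_mul,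
      inv_mul_cancel₀ (by positivity), ENNReal.ofReal_one]
  · have hterm : ∀ l : ZLat d, ((ENNReal.ofReal (expWeight c s ρ l))⁻¹) ^ 2 ≤
        ENNReal.ofReal Z⁻¹ * ENNReal.ofReal (japanese l ^ (-(2 * s₀))) := by
      intro l
      rw [← ENNReal.ofReal_inv_of_pos (hpos l), ← ENNReal.ofReal_pow (inv_nonneg.2 (hpos l).le),
        ← ENNReal.ofReal_mul (by positivity)]
      refine ENNReal.ofReal_le_ofReal ?_
      have hl := Real.rpow_pos_of_pos (japanese_pos l) s
      have h1 : (expWeight c s ρ l)⁻¹ ≤ Z⁻¹ * (japanese l ^ s)⁻¹ := by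
        rw [← mul_inv]
        refine inv_anti₀ (by positivity) ?_
        calc Z * japanese l ^ s = Z * japanese l ^ s * 1 := (mul_one _).symm
          _ ≤ c * japanese l ^ s * Real.exp (ρ * ‖l‖) := by
            have : 1 ≤ Real.exp (ρ * ‖l‖) := Real.one_le_exp (by positivity)
            gcongr
      refine (pow_le_pow_left₀ (inv_nonneg.2 (hpos l).le) h1 2).trans ?_
      rw [mul_pow]
      refine mul_le_mul ?_ (hjs l) (by positivity) (by positivity)
      have : Z⁻¹ ≤ 1 := inv_le_one_of_one_le₀ hZ
      have : 0 ≤ Z⁻¹ := by positivity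
      nlinarith
    refine (ENNReal.tsum_le_tsum hterm).trans ?_
    rw [ENNReal.tsum_mul_left]
    refine (mul_le_mul' le_rfl hZs).trans ?_
    rw [← ENNReal.ofReal_mul (by positivity), inv_mul_cancel₀ hZ0.ne', ENNReal.ofReal_one]

/-- Powers of `⟨k⟩` are absorbed by slowly growing exponentials. -/
theorem japanese_rpow_le_exp {t M : ℝ} (ht : 0 ≤ t) (hM : 1 ≤ M) (k : ZLat d) :
    japanese k ^ t ≤ (1 + t) ^ t * M ^ t * Real.exp (M⁻¹ * ‖k‖) := by
  have hM' : 0 < M := by linarith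
  have ht1 : 0 < 1 + t := by linarith
  -- Dividing by $1+t$ instead of $t$ covers $t=0$; after raising to the power $t$ the exponent
  -- gains the factor $t/(1+t)\le1$.
  set x := M⁻¹ * ‖k‖ / (1 + t) with hx
  have hx0 : 0 ≤ x := by positivity
  have h1 : japanese k ≤ (1 + t) * M * Real.exp x := by
    have he := Real.add_one_le_exp x
    have hMt : 1 ≤ (1 + t) * M := by nlinarith
    refine max_le ?_ ?_
    · nlinarith [Real.one_le_exp hx0]
    · calc ‖k‖ = (1 + t) * M * x := by
            rw [hx]
            field_simp
        _ ≤ _ := by gcongr; linarith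
  refine (Real.rpow_le_rpow (japanese_pos k).le h1 ht).trans ?_
  rw [Real.mul_rpow (by positivity) (Real.exp_pos _).le, Real.mul_rpow ht1.le hM'.le,
    ← Real.exp_mul]
  refine mul_le_mul_of_nonneg_left (Real.exp_le_exp.2 ?_) (by positivity)
  rw [hx, div_mul_eq_mul_div, div_le_iff₀ ht1]
  have : 0 ≤ M⁻¹ * ‖k‖ := by positivity
  nlinarith

end Weights

/-! ### The homological equation and one step of the scheme -/

namespace TransInvBanachAlg

variable {d : ℕ} {B : TransInvBanachAlg d} {K : Subfield ℂ}

theorem wnorm_add_le_ofReal {w : ZLat d → ℝ} {A C : LatOp d} {x y : ℝ} (hx : 0 ≤ x) (hy : 0 ≤ y)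
    (hA : B.wnorm K w A.ent ≤ ENNReal.ofReal x) (hC : B.wnorm K w C.ent ≤ ENNReal.ofReal y) :
    B.wnorm K w (A + C).ent ≤ ENNReal.ofReal (x + y) := by
  rw [ENNReal.ofReal_add hx hy]
  exact (wnorm_add_le w _ _).trans (add_le_add hA hC)

theorem wnorm_sub_le_ofReal {w : ZLat d → ℝ} {A C : LatOp d} {x y : ℝ} (hx : 0 ≤ x) (hy : 0 ≤ y)
    (hA : B.wnorm K w A.ent ≤ ENNReal.ofReal x) (hC : B.wnorm K w C.ent ≤ ENNReal.ofReal y) :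
    B.wnorm K w (A - C).ent ≤ ENNReal.ofReal (x + y) := by
  rw [ENNReal.ofReal_add hx hy]
  exact (wnorm_sub_le w _ _).trans (add_le_add hA hC)

theorem wnorm_mul_le_ofReal (hK : IsClosed (K : Set ℂ)) {w : ZLat d → ℝ} (hw : IsAlgWeight w)
    {A C : LatOp d} {x y : ℝ} (hx : 0 ≤ x)
    (hA : B.wnorm K w A.ent ≤ ENNReal.ofReal x) (hC : B.wnorm K w C.ent ≤ ENNReal.ofReal y) :
    B.wnorm K w (A * C).ent ≤ ENNReal.ofReal (x * y) := by
  rw [ENNReal.ofReal_mul hx]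
  exact (wnorm_mul_le hK hw A C).trans (mul_le_mul' hA hC)

/-- Solution of the homological equation `[p, W] = diag R - R` for a distal sequence `p`. -/
theorem exists_homological {w w' : ZLat d → ℝ} (hw' : IsAlgWeight w') {p : ZLat d → ℂ}
    (hpK : ∀ i, p i ∈ K) {τ γ : ℝ} (hγ : 0 < γ) (hp : B.Distal τ γ p) {Λ : ℝ}
    (hΛ0 : 0 ≤ Λ) (hΛ : ∀ k, γ⁻¹ * ‖k‖ ^ τ * w' k ≤ Λ * w k) {R R₀ : LatOp d}
    (hR₀ : R₀.ent = Matrix.diagonal fun i => R.ent i i) (hR : B.wnorm K w R.ent ≠ ⊤) :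
    ∃ W : LatOp d, LatOp.IsAd p W (R₀ - R) ∧
      B.wnorm K w' W.ent ≤ ENNReal.ofReal Λ * B.wnorm K w R.ent := by
  classical
  -- Off the main diagonal $M_k=-R_k\,(p-\sigma_kp)^{-1}$; the main diagonal, which the equation
  -- leaves free, is set to zero.
  let M : LatMat d := fun i j => -(R.ent i j * if i = j then 0 else (p i - p j)⁻¹)
  have hM : B.wnorm K w' M ≤ ENNReal.ofReal Λ * B.wnorm K w R.ent := by
    refine wnorm_le_mul_wnorm fun k => ?_
    by_cases hk : k = 0
    · have : kDiag M k = 0 := by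
        funext i
        simp [kDiag, M, hk]
      rw [this, bnorm_zero, zero_mul]
      exact zero_le
    · obtain ⟨-, h2, h3⟩ := hp k hk
      have e : kDiag M k = -(kDiag R.ent k * fun i => (p i - latShift k p i)⁻¹) := by
        funext i
        have : i ≠ i - k := fun h => hk (sub_eq_self.1 h.symm)
        simp [kDiag, M, latShift, this]
      have hinv : B.bnorm K (fun i => (p i - latShift k p i)⁻¹) ≤
          ENNReal.ofReal (γ⁻¹ * ‖k‖ ^ τ) := by
        rw [bnorm_eq h2 fun i => inv_mem (sub_mem (hpK _) (hpK _))]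
        exact ENNReal.ofReal_le_ofReal h3
      rw [e, bnorm_neg]
      refine (mul_le_mul' ((bnorm_mul_le _ _).trans (mul_le_mul' le_rfl hinv)) le_rfl).trans ?_
      rw [mul_assoc, mul_left_comm (ENNReal.ofReal Λ), ← ENNReal.ofReal_mul (by positivity),
        ← ENNReal.ofReal_mul hΛ0]
      exact mul_le_mul' le_rfl (ENNReal.ofReal_le_ofReal (hΛ k))
  obtain ⟨W, hW, -⟩ := exists_ent_eq_of_wnorm hw'
    (ne_top_of_le_ne_top (ENNReal.mul_ne_top ENNReal.ofReal_ne_top hR) hM)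
  refine ⟨W, fun i j => ?_, by rwa [hW]⟩
  rw [hW, LatOp.ent_sub, hR₀]
  by_cases hij : i = j
  · subst hij
    simp
  · have hne : p i - p j ≠ 0 := by
      have := (hp (i - j) (sub_ne_zero.2 hij)).1 i
      simpa [latShift] using this
    simp only [M, hij, if_false, Matrix.sub_apply, Matrix.diagonal_apply_ne _ hij]
    field_simp
    ring

/-- One step of the reducibility scheme. -/
theorem reducibility_step (hK : IsClosed (K : Set ℂ)) {w w' : ZLat d → ℝ} (hw : IsAlgWeight w)
    (hw' : IsAlgWeight w') (hww : ∀ k, w' k ≤ w k) {p u : ZLat d → ℂ}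
    (hpK : ∀ i, p i ∈ K) (huK : ∀ i, u i ∈ K) {τ γ : ℝ} (hγ : 0 < γ)
    (hp : B.Distal τ γ fun i => p i + u i) {Λ : ℝ} (hΛ0 : 0 ≤ Λ)
    (hΛ : ∀ k, γ⁻¹ * ‖k‖ ^ τ * w' k ≤ Λ * w k) {Q P R D T T' : LatOp d}
    (hD : D.ent = Matrix.diagonal u) (hPQ : P * Q = 1) (hQP : Q * P = 1)
    (had : LatOp.IsAd p Q (Q * (D + R) - T * Q)) {r q t : ℝ} (hr : 0 ≤ r) (hq : 0 ≤ q)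
    (ht : 0 ≤ t) (hR : B.wnorm K w R.ent ≤ ENNReal.ofReal r) (hΛr : Λ * r ≤ 1 / 2)
    (hQ : B.wnorm K w Q.ent ≤ ENNReal.ofReal q) (hP : B.wnorm K w P.ent ≤ ENNReal.ofReal q)
    (hT : B.wnorm K w' (T' - T).ent ≤ ENNReal.ofReal t) :
    ∃ (Q' P' R' D' : LatOp d) (u' : ZLat d → ℂ), D'.ent = Matrix.diagonal u' ∧
      P' * Q' = 1 ∧ Q' * P' = 1 ∧ LatOp.IsAd p Q' (Q' * (D' + R') - T' * Q') ∧
      B.bnorm K (u' - u) ≤ ENNReal.ofReal r ∧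
      B.wnorm K w' (Q' - Q).ent ≤ ENNReal.ofReal (q * (2 * (Λ * r))) ∧
      B.wnorm K w' (P' - P).ent ≤ ENNReal.ofReal (q * (2 * (Λ * r))) ∧
      B.wnorm K w' R'.ent ≤ ENNReal.ofReal (4 * (Λ * r) * r + 4 * q ^ 2 * t) := by
  have hRfin : B.wnorm K w R.ent ≠ ⊤ := ne_top_of_le_ne_top ENNReal.ofReal_ne_top hR
  have hω0 : 0 ≤ Λ * r := mul_nonneg hΛ0 hr
  have hR₀fin : B.wnorm K w (Matrix.diagonal fun i => R.ent i i) ≠ ⊤ :=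
    ne_top_of_le_ne_top hRfin (wnorm_diag_le w _)
  obtain ⟨R₀, hR₀, -⟩ := exists_ent_eq_of_wnorm hw hR₀fin
  obtain ⟨W, hW, hWn⟩ := exists_homological (B := B) hw' (fun i => add_mem (hpK i) (huK i)) hγ hp
    hΛ0 hΛ hR₀ hRfin
  replace hWn : B.wnorm K w' W.ent ≤ ENNReal.ofReal (Λ * r) := by
    rw [ENNReal.ofReal_mul hΛ0]
    exact hWn.trans (mul_le_mul' le_rfl hR)
  obtain ⟨V, hV1, hV2, hVn⟩ := exists_inverse_one_add hK hw' hω0 hΛr hWn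
  have hR' : B.wnorm K w' R.ent ≤ ENNReal.ofReal r := (wnorm_mono hww _).trans hR
  have hQ' : B.wnorm K w' Q.ent ≤ ENNReal.ofReal q := (wnorm_mono hww _).trans hQ
  have hP' : B.wnorm K w' P.ent ≤ ENNReal.ofReal q := (wnorm_mono hww _).trans hP
  have hR₀' : B.wnorm K w' R₀.ent ≤ ENNReal.ofReal r := by
    rw [hR₀]
    exact (wnorm_diag_le w' _).trans hR'
  -- The equation was solved for $p+u$; moving $[\operatorname{diag}u,W]=DW-WD$ to the right gives
  -- the commutator with $p$ alone.
  have hadW : LatOp.IsAd p W (R₀ - R - D * W + W * D) := by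
    intro i j
    have h := hW i j
    rw [LatOp.ent_add, LatOp.ent_sub, Matrix.add_apply, Matrix.sub_apply,
      LatOp.ent_diagonal_mul hD, LatOp.ent_mul_diagonal hD, ← h]
    ring
  set Q' := Q * (1 + W) with hQ'_def
  set P' := (1 + V) * P with hP'_def
  have hPQ' : P' * Q' = 1 := by
    rw [hQ'_def, hP'_def, mul_assoc, ← mul_assoc P, hPQ, one_mul, hV1]
  have hQP' : Q' * P' = 1 := by
    rw [hQ'_def, hP'_def, mul_assoc, ← mul_assoc (1 + W), hV2, one_mul, hQP]
  have hQQ : B.wnorm K w' (Q' - Q).ent ≤ ENNReal.ofReal (q * (Λ * r)) := by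
    have e : Q' - Q = Q * W := by rw [hQ'_def]; noncomm_ring
    rw [e]
    exact wnorm_mul_le_ofReal hK hw' hq hQ' hWn
  have hPP : B.wnorm K w' (P' - P).ent ≤ ENNReal.ofReal (q * (2 * (Λ * r))) := by
    have e : P' - P = V * P := by rw [hP'_def]; noncomm_ring
    rw [e, mul_comm q]
    exact wnorm_mul_le_ofReal hK hw' (by positivity) hVn hP'
  have hQ'n : B.wnorm K w' Q'.ent ≤ ENNReal.ofReal (2 * q) := by
    have := wnorm_add_le_ofReal (by positivity) hq hQQ hQ'
    rw [sub_add_cancel] at this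
    refine this.trans (ENNReal.ofReal_le_ofReal ?_)
    nlinarith
  have hP'n : B.wnorm K w' P'.ent ≤ ENNReal.ofReal (2 * q) := by
    have := wnorm_add_le_ofReal (by positivity) hq hPP hP'
    rw [sub_add_cancel] at this
    refine this.trans (ENNReal.ofReal_le_ofReal ?_)
    nlinarith
  -- By the choice of $W$, $(p+u+R)(1+W)=(1+W)(p+u+\operatorname{diag}R)+X$: the part linear in $R$
  -- has cancelled.
  set X := R * W - W * R₀ with hX_def
  have hXn : B.wnorm K w' X.ent ≤ ENNReal.ofReal (r * (Λ * r) + Λ * r * r) :=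
    wnorm_sub_le_ofReal (by positivity) (by positivity)
      (wnorm_mul_le_ofReal hK hw' hr hR' hWn) (wnorm_mul_le_ofReal hK hw' hω0 hWn hR₀')
  -- The new remainder is $(1+W)^{-1}X$ together with the conjugated change from $T$ to $T'$.
  refine ⟨Q', P', X + V * X + P' * (T' - T) * Q', D + R₀, fun i => u i + R.ent i i, ?_, hPQ', hQP',
    ?_, ?_, ?_, hPP, ?_⟩
  · rw [LatOp.ent_add, hD, hR₀, Matrix.diagonal_add]
  · have hQ'ad := had.mul (LatOp.isAd_one.add hadW)
    have e1 : Q' * (P' * (T' - T) * Q') = (T' - T) * Q' := by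
      rw [mul_assoc P', ← mul_assoc Q', hQP', one_mul]
    have e2 : Q' * (X + V * X) = Q * X := by
      have : X + V * X = (1 + V) * X := by noncomm_ring
      rw [this, hQ'_def, mul_assoc, ← mul_assoc (1 + W), hV2, one_mul]
    have e : Q' * (D + R₀ + (X + V * X + P' * (T' - T) * Q')) - T' * Q' =
        (Q * (D + R) - T * Q) * (1 + W) + Q * (0 + (R₀ - R - D * W + W * D)) := by
      rw [mul_add Q' (D + R₀), mul_add Q' (X + V * X), e1, e2, hQ'_def, hX_def]
      noncomm_ring
    rw [e]
    exact hQ'ad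
  · have e : (fun i => u i + R.ent i i) - u = fun i => R.ent i i := by
      funext i
      simp
    rw [e]
    exact (bnorm_diag_le hw R.ent).trans hR
  · exact hQQ.trans (ENNReal.ofReal_le_ofReal (by nlinarith))
  · have h1 : B.wnorm K w' (X + V * X).ent ≤ ENNReal.ofReal
        (r * (Λ * r) + Λ * r * r + 2 * (Λ * r) * (r * (Λ * r) + Λ * r * r)) :=
      wnorm_add_le_ofReal (by positivity) (by positivity) hXn
        (wnorm_mul_le_ofReal hK hw' (by positivity) hVn hXn)
    have h2 : B.wnorm K w' (P' * (T' - T) * Q').ent ≤ ENNReal.ofReal (2 * q * t * (2 * q)) :=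
      wnorm_mul_le_ofReal hK hw' (by positivity)
        (wnorm_mul_le_ofReal hK hw' (by positivity) hP'n hT) hQ'n
    refine (wnorm_add_le_ofReal (by positivity) (by positivity) h1 h2).trans
      (ENNReal.ofReal_le_ofReal ?_)
    have : 2 * (Λ * r) * (r * (Λ * r) + Λ * r * r) ≤ 1 * (r * (Λ * r) + Λ * r * r) :=
      mul_le_mul_of_nonneg_right (by linarith) (by positivity)
    nlinarith

end TransInvBanachAlg

/-! ### Iteration of the step and passage to the limit -/

theorem exists_seq_of_forall_exists {α : Type*} {P : ℕ → α → Prop} {S : ℕ → α → α → Prop} {a : α}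
    (h0 : P 0 a) (h : ∀ n x, P n x → ∃ y, P (n + 1) y ∧ S n x y) :
    ∃ f : ℕ → α, f 0 = a ∧ ∀ n, P n (f n) ∧ S n (f n) (f (n + 1)) := by
  choose! g hg using h
  let f : ℕ → α := fun n => Nat.rec a g n
  have hf : ∀ n, P n (f n) := fun n => by
    induction n with
    | zero => exact h0
    | succ n ih => exact (hg n (f n) ih).1
  exact ⟨f, rfl, fun n => ⟨hf n, (hg n (f n) (hf n)).2⟩⟩

namespace TransInvBanachAlg

variable {d : ℕ} {B : TransInvBanachAlg d} {K : Subfield ℂ}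

/-- The increments are summable in operator norm, which the weighted norm dominates; the weighted
bound on the limit then comes from countable subadditivity. -/
theorem exists_limit_of_summable (hK : IsClosed (K : Set ℂ)) {v : ZLat d → ℝ} (hv : IsAlgWeight v)
    {A : ℕ → LatOp d} {e : ℕ → ℝ} (he0 : ∀ n, 0 ≤ e n) (hs : Summable e)
    (h : ∀ n, B.wnorm K v (A (n + 1) - A n).ent ≤ ENNReal.ofReal (e n)) :
    ∃ A' : LatOp d, Tendsto A atTop (𝓝 A') ∧
      B.wnorm K v (A' - A 0).ent ≤ ENNReal.ofReal (∑' n, e n) := by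
  have hsum : Summable fun n => A (n + 1) - A n :=
    Summable.of_norm_bounded hs fun n => norm_le_of_wnorm_le hv (he0 n) (h n)
  refine ⟨A 0 + ∑' n, (A (n + 1) - A n), ?_, ?_⟩
  · have := hsum.hasSum.tendsto_sum_nat.const_add (A 0)
    simpa only [Finset.sum_range_sub, add_sub_cancel] using this
  · rw [add_sub_cancel_left]
    refine (wnorm_le_tsum hK v (LatOp.hasSum_ent hsum.hasSum)).trans ?_
    rw [ENNReal.ofReal_tsum_of_nonneg he0 hs]
    exact ENNReal.tsum_le_tsum h

/-- The reducibility scheme along a decreasing sequence of weights. -/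
theorem exists_reducibility_seq (hK : IsClosed (K : Set ℂ)) {w : ℕ → ZLat d → ℝ}
    (hw : ∀ n, IsAlgWeight (w n)) (hww : ∀ n k, w (n + 1) k ≤ w n k) {c : ℝ}
    (hwc : ∀ n, w n 0 = c) {p : ZLat d → ℂ} (hpK : ∀ i, p i ∈ K) {τ γ η : ℝ} (hγ : 0 < γ)
    (hp : ∀ u : ZLat d → ℂ, B.bnorm K u ≤ ENNReal.ofReal η → B.Distal τ γ fun i => p i + u i)
    {Λ r t : ℕ → ℝ} {q : ℝ} (hΛ0 : ∀ n, 0 ≤ Λ n) (hr0 : ∀ n, 0 ≤ r n) (ht0 : ∀ n, 0 ≤ t n)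
    (hΛ : ∀ n k, γ⁻¹ * ‖k‖ ^ τ * w (n + 1) k ≤ Λ n * w n k)
    {T : ℕ → LatOp d} (hT0 : B.wnorm K (w 0) (T 0).ent ≤ ENNReal.ofReal (r 0))
    (hT : ∀ n, B.wnorm K (w (n + 1)) (T (n + 1) - T n).ent ≤ ENNReal.ofReal (t n))
    (hr : ∀ n, 4 * (Λ n * r n) * r n + 4 * q ^ 2 * t n ≤ r (n + 1))
    (hΛr : ∀ n, Λ n * r n ≤ 1 / 2) (hc0 : 0 ≤ c) (hq0 : 0 ≤ q)
    (hq : ∀ n, c + ∑ m ∈ Finset.range n, q * (2 * (Λ m * r m)) ≤ q)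
    (hη : ∀ n, ∑ m ∈ Finset.range n, r m ≤ η) :
    ∃ Q P R D : ℕ → LatOp d, Q 0 = 1 ∧ P 0 = 1 ∧ D 0 = 0 ∧ ∀ n,
      (∃ u, (D n).ent = Matrix.diagonal u) ∧ P n * Q n = 1 ∧ Q n * P n = 1 ∧
      LatOp.IsAd p (Q n) (Q n * (D n + R n) - T n * Q n) ∧
      B.wnorm K (w n) (R n).ent ≤ ENNReal.ofReal (r n) ∧
      B.wnorm K (w (n + 1)) (Q (n + 1) - Q n).ent ≤ ENNReal.ofReal (q * (2 * (Λ n * r n))) ∧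
      B.wnorm K (w (n + 1)) (P (n + 1) - P n).ent ≤ ENNReal.ofReal (q * (2 * (Λ n * r n))) ∧
      ∀ v : ZLat d → ℝ, B.wnorm K v (D (n + 1) - D n).ent ≤ ENNReal.ofReal (v 0 * r n) := by
  let e : ℕ → ℝ := fun m => q * (2 * (Λ m * r m))
  have he0 : ∀ m, 0 ≤ e m := fun m =>
    mul_nonneg hq0 (mul_nonneg two_pos.le (mul_nonneg (hΛ0 m) (hr0 m)))
  have hes : ∀ n, 0 ≤ c + ∑ m ∈ Finset.range n, e m := fun n =>
    add_nonneg hc0 (Finset.sum_nonneg fun m _ => he0 m)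
  -- The norms of $Q$ and $P$ are tracked by partial sums starting from $\|1\|=c$, which `hq` keeps
  -- below $q$; the bound on $u$ keeps $p+u$ distal by `hη`.
  let good : ℕ → (LatOp d × LatOp d × LatOp d × LatOp d × (ZLat d → ℂ)) → Prop :=
    fun n ⟨Q, P, R, D, u⟩ => D.ent = Matrix.diagonal u ∧ P * Q = 1 ∧ Q * P = 1 ∧
      LatOp.IsAd p Q (Q * (D + R) - T n * Q) ∧ B.wnorm K (w n) R.ent ≤ ENNReal.ofReal (r n) ∧
      B.wnorm K (w n) Q.ent ≤ ENNReal.ofReal (c + ∑ m ∈ Finset.range n, e m) ∧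
      B.wnorm K (w n) P.ent ≤ ENNReal.ofReal (c + ∑ m ∈ Finset.range n, e m) ∧
      B.bnorm K u ≤ ENNReal.ofReal (∑ m ∈ Finset.range n, r m)
  let close : ℕ → (LatOp d × LatOp d × LatOp d × LatOp d × (ZLat d → ℂ)) →
      (LatOp d × LatOp d × LatOp d × LatOp d × (ZLat d → ℂ)) → Prop :=
    fun n ⟨Q, P, _, _, u⟩ ⟨Q', P', _, _, u'⟩ =>
      B.wnorm K (w (n + 1)) (Q' - Q).ent ≤ ENNReal.ofReal (e n) ∧
      B.wnorm K (w (n + 1)) (P' - P).ent ≤ ENNReal.ofReal (e n) ∧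
      B.bnorm K (u' - u) ≤ ENNReal.ofReal (r n)
  have h0 : good 0 (1, 1, T 0, 0, 0) := by
    refine ⟨?_, one_mul _, one_mul _, ?_, hT0, ?_, ?_, ?_⟩
    · rw [LatOp.ent_zero, Matrix.diagonal_zero']
    · have : (1 : LatOp d) * (0 + T 0) - T 0 * 1 = 0 := by simp
      rw [this]
      exact LatOp.isAd_one
    · rw [LatOp.ent_one, wnorm_one, hwc]
      simp
    · rw [LatOp.ent_one, wnorm_one, hwc]
      simp
    · simp [bnorm_zero]
  have hstep : ∀ n x, good n x → ∃ y, good (n + 1) y ∧ close n x y := by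
    rintro n ⟨Q, P, R, D, u⟩ ⟨hD, hPQ, hQP, had, hR, hQ, hP, hu⟩
    have huK : ∀ i, u i ∈ K := (bnorm_ne_top_iff.1 (ne_top_of_le_ne_top ENNReal.ofReal_ne_top hu)).2
    obtain ⟨Q', P', R', D', u', hD', hPQ', hQP', had', hu', hQQ, hPP, hR'⟩ :=
      reducibility_step hK (hw n) (hw (n + 1)) (hww n) hpK huK hγ
        (hp u (hu.trans (ENNReal.ofReal_le_ofReal (hη n)))) (hΛ0 n) (hΛ n) hD hPQ hQP had
        (hr0 n) hq0 (ht0 n) hR (hΛr n) (hQ.trans (ENNReal.ofReal_le_ofReal (hq n)))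
        (hP.trans (ENNReal.ofReal_le_ofReal (hq n))) (hT n)
    refine ⟨(Q', P', R', D', u'), ⟨hD', hPQ', hQP', had',
      hR'.trans (ENNReal.ofReal_le_ofReal (hr n)), ?_, ?_, ?_⟩, hQQ, hPP, hu'⟩
    · have := wnorm_add_le_ofReal (hes n) (he0 n) ((wnorm_mono (hww n) _).trans hQ) hQQ
      rw [add_sub_cancel] at this
      rwa [Finset.sum_range_succ, ← add_assoc]
    · have := wnorm_add_le_ofReal (hes n) (he0 n) ((wnorm_mono (hww n) _).trans hP) hPP
      rw [add_sub_cancel] at this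
      rwa [Finset.sum_range_succ, ← add_assoc]
    · have := (bnorm_add_le u (u' - u)).trans (add_le_add hu hu')
      rw [add_sub_cancel] at this
      rwa [Finset.sum_range_succ, ENNReal.ofReal_add (Finset.sum_nonneg fun m _ => hr0 m) (hr0 n)]
  obtain ⟨f, hf0, hf⟩ := exists_seq_of_forall_exists h0 hstep
  refine ⟨fun n => (f n).1, fun n => (f n).2.1, fun n => (f n).2.2.1, fun n => (f n).2.2.2.1,
    by simp only [hf0], by simp only [hf0], by simp only [hf0], fun n => ?_⟩
  obtain ⟨⟨g1, g2, g3, g4, g5, -⟩, g6, g7, g8⟩ := hf n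
  refine ⟨⟨_, g1⟩, g2, g3, g4, g5, g6, g7, fun v => ?_⟩
  -- A diagonal matrix sees a weight only at $k=0$, so its increments can be measured with any
  -- weight.
  have e1 : ((f (n + 1)).2.2.2.1 - (f n).2.2.2.1).ent =
      Matrix.diagonal ((f (n + 1)).2.2.2.2 - (f n).2.2.2.2) := by
    rw [LatOp.ent_sub, g1, (hf (n + 1)).1.1, Matrix.diagonal_sub]
    rfl
  rw [e1, wnorm_diagonal, mul_comm (v 0), ENNReal.ofReal_mul (hr0 n)]
  exact mul_le_mul' g8 le_rfl

/-- Reducibility in the limit of the scheme, measured with a weight `v`. -/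
theorem exists_reducibility (hK : IsClosed (K : Set ℂ)) {w : ℕ → ZLat d → ℝ}
    (hw : ∀ n, IsAlgWeight (w n)) (hww : ∀ n k, w (n + 1) k ≤ w n k) {c : ℝ}
    (hwc : ∀ n, w n 0 = c) {p : ZLat d → ℂ} (hpK : ∀ i, p i ∈ K) {τ γ η : ℝ} (hγ : 0 < γ)
    (hp : ∀ u : ZLat d → ℂ, B.bnorm K u ≤ ENNReal.ofReal η → B.Distal τ γ fun i => p i + u i)
    {Λ r t : ℕ → ℝ} {q : ℝ} (hΛ0 : ∀ n, 0 ≤ Λ n) (hr0 : ∀ n, 0 ≤ r n) (ht0 : ∀ n, 0 ≤ t n)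
    (hΛ : ∀ n k, γ⁻¹ * ‖k‖ ^ τ * w (n + 1) k ≤ Λ n * w n k)
    {T : ℕ → LatOp d} (hT0 : B.wnorm K (w 0) (T 0).ent ≤ ENNReal.ofReal (r 0))
    (hT : ∀ n, B.wnorm K (w (n + 1)) (T (n + 1) - T n).ent ≤ ENNReal.ofReal (t n))
    (hr : ∀ n, 4 * (Λ n * r n) * r n + 4 * q ^ 2 * t n ≤ r (n + 1))
    (hΛr : ∀ n, Λ n * r n ≤ 1 / 2) (hc0 : 0 ≤ c) (hq0 : 0 ≤ q)
    (hq : ∀ n, c + ∑ m ∈ Finset.range n, q * (2 * (Λ m * r m)) ≤ q)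
    (hrs : Summable r) (hη : ∑' m, r m ≤ η) {T' : LatOp d} (hT' : Tendsto T atTop (𝓝 T'))
    {v : ZLat d → ℝ} (hv : IsAlgWeight v) {κ : ℕ → ℝ} (hκ0 : ∀ n, 0 ≤ κ n)
    (hκ : ∀ n k, v k ≤ κ n * w (n + 1) k)
    (hs : Summable fun n => κ n * (q * (2 * (Λ n * r n)))) :
    ∃ (Q P D : LatOp d) (u : ZLat d → ℂ), D.ent = Matrix.diagonal u ∧ P * Q = 1 ∧ Q * P = 1 ∧
      LatOp.IsAd p Q (Q * D - T' * Q) ∧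
      B.wnorm K v (Q - 1).ent ≤ ENNReal.ofReal (∑' n, κ n * (q * (2 * (Λ n * r n)))) ∧
      B.wnorm K v (P - 1).ent ≤ ENNReal.ofReal (∑' n, κ n * (q * (2 * (Λ n * r n)))) ∧
      B.bnorm K u ≤ ENNReal.ofReal (v 0 * ∑' n, r n) := by
  obtain ⟨Q, P, R, D, hQ0, hP0, hD0, h⟩ := exists_reducibility_seq hK hw hww hwc hpK hγ hp hΛ0 hr0
    ht0 hΛ hT0 hT hr hΛr hc0 hq0 hq
    fun n => (hrs.sum_le_tsum _ fun m _ => hr0 m).trans hη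
  have he0 : ∀ n, 0 ≤ κ n * (q * (2 * (Λ n * r n))) := fun n =>
    mul_nonneg (hκ0 n) (mul_nonneg hq0 (mul_nonneg two_pos.le (mul_nonneg (hΛ0 n) (hr0 n))))
  have hκw : ∀ n (A : LatOp d), B.wnorm K (w (n + 1)) A.ent ≤
      ENNReal.ofReal (q * (2 * (Λ n * r n))) →
      B.wnorm K v A.ent ≤ ENNReal.ofReal (κ n * (q * (2 * (Λ n * r n)))) := fun n A hA => by
    rw [ENNReal.ofReal_mul (hκ0 n)]
    exact (wnorm_le_of_weight_le (hκ0 n) (hκ n) _).trans (mul_le_mul' le_rfl hA)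
  obtain ⟨Q', hQ', hQn⟩ := exists_limit_of_summable hK hv he0 hs fun n => hκw n _ (h n).2.2.2.2.2.1
  obtain ⟨P', hP', hPn⟩ :=
    exists_limit_of_summable hK hv he0 hs fun n => hκw n _ (h n).2.2.2.2.2.2.1
  obtain ⟨D', hD', hDn⟩ := exists_limit_of_summable hK hv
    (fun n => mul_nonneg (hv.pos 0).le (hr0 n)) (hrs.mul_left (v 0))
    fun n => (h n).2.2.2.2.2.2.2 v
  -- The weights vary with $n$, but each of them dominates the operator norm with constant one.
  have hR' : Tendsto R atTop (𝓝 0) :=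
    squeeze_zero_norm (fun n => norm_le_of_wnorm_le (hw n) (hr0 n) (h n).2.2.2.2.1)
      hrs.tendsto_atTop_zero
  rw [hQ0] at hQn
  rw [hP0] at hPn
  rw [hD0, sub_zero, tsum_mul_left] at hDn
  refine ⟨Q', P', D', fun i => D'.ent i i, ?_, ?_, ?_, ?_, hQn, hPn, ?_⟩
  · ext i j
    by_cases hij : i = j
    · simp [hij]
    · rw [Matrix.diagonal_apply_ne _ hij]
      refine tendsto_nhds_unique (LatOp.tendsto_ent hD' i j)
        (tendsto_const_nhds.congr fun n => ?_)
      obtain ⟨u, hu⟩ := (h n).1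
      rw [hu, Matrix.diagonal_apply_ne _ hij]
  · exact tendsto_nhds_unique (hP'.mul hQ') (tendsto_const_nhds.congr fun n => (h n).2.1.symm)
  · exact tendsto_nhds_unique (hQ'.mul hP') (tendsto_const_nhds.congr fun n => (h n).2.2.1.symm)
  · have := (hQ'.mul (hD'.add hR')).sub (hT'.mul hQ')
    rw [add_zero] at this
    exact LatOp.IsAd.of_tendsto (fun n => (h n).2.2.2.1) hQ' this
  · exact (bnorm_diag_le hv D'.ent).trans hDn

end TransInvBanachAlg

/-! ### Approximation by dyadic bands -/

theorem two_pow_rpow (n : ℕ) (y : ℝ) : ((2 : ℝ) ^ n) ^ y = ((2 : ℝ) ^ y) ^ n := by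
  rw [← Real.rpow_natCast, ← Real.rpow_mul two_pos.le, mul_comm, Real.rpow_mul two_pos.le,
    Real.rpow_natCast]

/-- The part of a matrix within distance `N` of the diagonal. -/
noncomputable def bandPart {d : ℕ} (N : ℝ) (T : LatMat d) : LatMat d :=
  fun i j => if ‖i - j‖ ≤ N then T i j else 0

theorem kDiag_bandPart {d : ℕ} (N : ℝ) (T : LatMat d) (k : ZLat d) :
    kDiag (bandPart N T) k = if ‖k‖ ≤ N then kDiag T k else 0 := by
  funext i
  simp only [kDiag, bandPart, sub_sub_cancel]
  split_ifs <;> rfl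

theorem kDiag_sub {d : ℕ} (M M' : LatMat d) (k : ZLat d) :
    kDiag (M - M') k = kDiag M k - kDiag M' k := rfl

namespace TransInvBanachAlg

variable {d : ℕ} {B : TransInvBanachAlg d} {K : Subfield ℂ}

/-- Diagonals far from the main one are small in weaker norms. -/
theorem wnorm_expWeight_le {c s b ρ N : ℝ} (hc : 0 ≤ c) (hb : 0 ≤ b) (hN : 0 < N) {M T : LatMat d}
    (h : ∀ k, kDiag M k = 0 ∨ (kDiag M k = kDiag T k ∧ N ≤ japanese k ∧ ρ * ‖k‖ ≤ 1)) :
    B.wnorm K (expWeight c s ρ) M ≤ ENNReal.ofReal (c * Real.exp 1 * N ^ (-b)) *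
      B.wnorm K (fun k => japanese k ^ (s + b)) T := by
  refine wnorm_le_mul_wnorm fun k => ?_
  rcases h k with h0 | ⟨h1, h2, h3⟩
  · rw [h0, bnorm_zero, zero_mul]
    exact zero_le
  · rw [h1, mul_left_comm, ← ENNReal.ofReal_mul (by positivity)]
    refine mul_le_mul' le_rfl (ENNReal.ofReal_le_ofReal ?_)
    have hj := japanese_pos k
    have e1 : (1 : ℝ) ≤ N ^ (-b) * japanese k ^ b := by
      rw [Real.rpow_neg hN.le, ← div_eq_inv_mul, one_le_div (Real.rpow_pos_of_pos hN b)]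
      exact Real.rpow_le_rpow hN.le h2 hb
    rw [expWeight, Real.rpow_add hj]
    have e2 := Real.exp_le_exp.2 h3
    have e3 := Real.rpow_pos_of_pos hj s
    calc c * japanese k ^ s * Real.exp (ρ * ‖k‖) ≤ c * japanese k ^ s * Real.exp 1 := by gcongr
      _ = c * Real.exp 1 * japanese k ^ s * 1 := by ring
      _ ≤ c * Real.exp 1 * japanese k ^ s * (N ^ (-b) * japanese k ^ b) := by gcongr
      _ = _ := by ring

/-- Dyadic band approximations of a matrix of finite Sobolev norm. -/
theorem exists_band_approx {Z s b c ε : ℝ} (hZ : 1 ≤ Z)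
    (hZs : ∑' k : ZLat d, ENNReal.ofReal (japanese k ^ (-(2 * s))) ≤ ENNReal.ofReal Z)
    (hs : 0 ≤ s) (hb : 0 < b) (hc : c = 2 ^ (s + 1) * Z) (hε : 0 ≤ ε) {T : LatMat d}
    (hT : B.wnorm K (fun k => japanese k ^ (s + b)) T ≤ ENNReal.ofReal ε) :
    ∃ (T' : LatOp d) (A : ℕ → LatOp d), T'.ent = T ∧ Tendsto A atTop (𝓝 T') ∧
      B.wnorm K (expWeight c s ((2 : ℝ) ^ 0)⁻¹) (A 0).ent ≤
        ENNReal.ofReal (c * Real.exp 1 * ε) ∧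
      ∀ n, B.wnorm K (expWeight c s ((2 : ℝ) ^ (n + 1))⁻¹) (A (n + 1) - A n).ent ≤
        ENNReal.ofReal (c * Real.exp 1 * ((2 : ℝ) ^ (-b)) ^ n * ε) := by
  have hc0 : 0 ≤ c := by rw [hc]; positivity
  have hw : IsAlgWeight (expWeight c s 0 : ZLat d → ℝ) :=
    isAlgWeight_expWeight hZ hZs hs le_rfl hc le_rfl
  have key : ∀ {ρ N : ℝ} {M : LatMat d}, 0 < N →
      (∀ k, kDiag M k = 0 ∨ (kDiag M k = kDiag T k ∧ N ≤ japanese k ∧ ρ * ‖k‖ ≤ 1)) →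
      B.wnorm K (expWeight c s ρ) M ≤ ENNReal.ofReal (c * Real.exp 1 * N ^ (-b) * ε) := by
    intro ρ N M hN h
    rw [ENNReal.ofReal_mul (by positivity)]
    exact (wnorm_expWeight_le hc0 hb.le hN h).trans (mul_le_mul' le_rfl hT)
  have hTfin : B.wnorm K (expWeight c s 0) T ≠ ⊤ :=
    ne_top_of_le_ne_top ENNReal.ofReal_ne_top
      (key one_pos fun k => Or.inr ⟨rfl, one_le_japanese k, by simp⟩)
  have hband : ∀ n : ℕ, B.wnorm K (expWeight c s 0) (bandPart (2 ^ n) T) ≠ ⊤ := fun n =>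
    ne_top_of_le_ne_top ENNReal.ofReal_ne_top (key one_pos fun k => by
      rw [kDiag_bandPart]
      split_ifs
      · exact Or.inr ⟨rfl, one_le_japanese k, by simp⟩
      · exact Or.inl rfl)
  obtain ⟨T', hT', -⟩ := exists_ent_eq_of_wnorm hw hTfin
  choose A hA _ using fun n => exists_ent_eq_of_wnorm hw (hband n)
  refine ⟨T', A, hT', ?_, ?_, fun n => ?_⟩
  · have hlim : Tendsto (fun n : ℕ => c * Real.exp 1 * ((2 : ℝ) ^ (-b)) ^ n * ε) atTop (𝓝 0) := by
      have : Tendsto (fun n : ℕ => ((2 : ℝ) ^ (-b)) ^ n) atTop (𝓝 0) :=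
        tendsto_pow_atTop_nhds_zero_of_lt_one (by positivity)
          (Real.rpow_lt_one_of_one_lt_of_neg one_lt_two (by linarith))
      simpa using (this.const_mul (c * Real.exp 1)).mul_const ε
    rw [tendsto_iff_norm_sub_tendsto_zero]
    refine squeeze_zero (fun _ => norm_nonneg _) (fun n => ?_) hlim
    refine norm_le_of_wnorm_le (B := B) (K := K) hw (by positivity) ?_
    rw [← neg_sub, LatOp.ent_neg, wnorm_neg, ← two_pow_rpow, LatOp.ent_sub, hT', hA]
    refine key (by positivity) fun k => ?_
    rw [kDiag_sub, kDiag_bandPart]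
    split_ifs with h
    · exact Or.inl (sub_self _)
    · exact Or.inr ⟨sub_zero _, (not_le.1 h).le.trans (le_max_right _ _), by simp⟩
  · rw [hA]
    have h1 := key (ρ := ((2 : ℝ) ^ 0)⁻¹) (N := 1) (M := bandPart (2 ^ 0) T) one_pos fun k => by
      rw [kDiag_bandPart]
      split_ifs with h
      · exact Or.inr ⟨rfl, one_le_japanese k, by simpa using h⟩
      · exact Or.inl rfl
    simpa using h1
  -- The difference lives on $2^n<|k|\le2^{n+1}$: the lower bound yields the gain $2^{-bn}$, the
  -- upper one keeps $e^{2^{-(n+1)}|k|}\le e$.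
  · rw [← two_pow_rpow, LatOp.ent_sub, hA, hA]
    refine key (by positivity) fun k => ?_
    rw [kDiag_sub, kDiag_bandPart, kDiag_bandPart]
    by_cases h : ‖k‖ ≤ 2 ^ n
    · have h' : ‖k‖ ≤ 2 ^ (n + 1) := h.trans (pow_le_pow_right₀ one_le_two (Nat.le_succ n))
      simp [h, h']
    · by_cases h' : ‖k‖ ≤ 2 ^ (n + 1)
      · refine Or.inr ⟨by simp [h, h'], (not_le.1 h).le.trans (le_max_right _ _), ?_⟩
        rw [inv_mul_le_iff₀ (by positivity), mul_one]
        exact h'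
      · simp [h, h']

end TransInvBanachAlg

/-! ### Choice of the parameters of the scheme -/

/-- Reducibility with constants that depend only on the exponents and on the bound `Z` for
`∑ ⟨k⟩ ^ (-2 α₀)`. -/
theorem exists_reducibility_const {Z α₀ τ b s c' : ℝ} (hZ : 1 ≤ Z) (hα₀ : 0 ≤ α₀) (hτ : 0 ≤ τ)
    (hs : α₀ ≤ s) (hb : s - α₀ + τ < b) (hc' : c' = 2 ^ (s + 1) * Z) :
    ∃ C μ : ℝ, 0 < C ∧ 0 < μ ∧ ∀ (γ η : ℝ), 0 < γ → ∀ (d : ℕ),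
      ∑' k : ZLat d, ENNReal.ofReal (japanese k ^ (-(2 * α₀))) ≤ ENNReal.ofReal Z →
      ∀ (B : TransInvBanachAlg d) (K : Subfield ℂ), IsClosed (K : Set ℂ) →
      ∀ (p : ZLat d → ℂ) (T : LatMat d) (ε : ℝ), (∀ i, p i ∈ K) →
      (∀ u : ZLat d → ℂ, B.bnorm K u ≤ ENNReal.ofReal η → B.Distal τ γ fun i => p i + u i) →
      0 ≤ ε → γ⁻¹ * ε ≤ μ → ε ≤ μ * η →
      B.wnorm K (fun k => japanese k ^ (α₀ + b)) T ≤ ENNReal.ofReal ε →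
      ∃ (Q P D T' : LatOp d) (u : ZLat d → ℂ), T'.ent = T ∧ D.ent = Matrix.diagonal u ∧
        P * Q = 1 ∧ Q * P = 1 ∧ LatOp.IsAd p Q (Q * D - T' * Q) ∧
        B.wnorm K (expWeight c' s 0) (Q - 1).ent ≤ ENNReal.ofReal (C * (γ⁻¹ * ε)) ∧
        B.wnorm K (expWeight c' s 0) (P - 1).ent ≤ ENNReal.ofReal (C * (γ⁻¹ * ε)) ∧
        B.bnorm K u ≤ ENNReal.ofReal (C * ε) := by
  obtain ⟨c, hc⟩ : ∃ c : ℝ, c = 2 ^ (α₀ + 1) * Z := ⟨_, rfl⟩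
  have hc1 : 1 ≤ c := by
    rw [hc]
    exact one_le_mul_of_one_le_of_one_le (Real.one_le_rpow one_le_two (by linarith)) hZ
  have hc'0 : 0 < c' := by rw [hc']; positivity
  -- Ratios per step: $x$ is the decay of the remainders, $y_2$ the growth of the small divisor
  -- constant, $g$ the cost of returning to the weight $\langle k\rangle^s$. The decisive inequality
  -- is $g\,y_2\,x<1$, that is, the hypothesis `hb`.
  obtain ⟨x, hx⟩ : ∃ x : ℝ, x = 2 ^ (-b) := ⟨_, rfl⟩
  obtain ⟨y₂, hy₂⟩ : ∃ y : ℝ, y = 2 ^ τ := ⟨_, rfl⟩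
  obtain ⟨g, hg⟩ : ∃ g : ℝ, g = 2 ^ (s - α₀) := ⟨_, rfl⟩
  have hx0 : 0 < x := by rw [hx]; positivity
  have hy₂0 : 1 ≤ y₂ := by rw [hy₂]; exact Real.one_le_rpow one_le_two hτ
  have hg1 : 1 ≤ g := by rw [hg]; exact Real.one_le_rpow one_le_two (by linarith)
  have hx1 : x < 1 := by
    rw [hx]
    exact Real.rpow_lt_one_of_one_lt_of_neg one_lt_two (by linarith)
  have hy1 : y₂ * x < 1 := by
    rw [hx, hy₂, ← Real.rpow_add two_pos]
    exact Real.rpow_lt_one_of_one_lt_of_neg one_lt_two (by linarith)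
  have hz1 : g * (y₂ * x) < 1 := by
    rw [hx, hy₂, hg, ← Real.rpow_add two_pos, ← Real.rpow_add two_pos]
    exact Real.rpow_lt_one_of_one_lt_of_neg one_lt_two (by linarith)
  obtain ⟨Cτ, hCτ⟩ : ∃ C : ℝ, C = (1 + τ) ^ τ := ⟨_, rfl⟩
  have hCτ0 : 0 < Cτ := by rw [hCτ]; positivity
  obtain ⟨Cg, hCg⟩ : ∃ C : ℝ, C = (1 + (s - α₀)) ^ (s - α₀) := ⟨_, rfl⟩
  have hCg0 : 0 < Cg := by
    rw [hCg]
    exact Real.rpow_pos_of_pos (by linarith) _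
  obtain ⟨q, hq⟩ : ∃ q : ℝ, q = c + 1 := ⟨_, rfl⟩
  have hq0 : 0 < q := by linarith
  have he0 : 1 ≤ Real.exp 1 := Real.one_le_exp zero_le_one
  -- With $r_n=G\epsilon x^n$ this value makes the band contribution $4q^2t_n$ exactly $r_{n+1}/2$.
  obtain ⟨G, hG⟩ : ∃ G : ℝ, G = 8 * q ^ 2 * (c * Real.exp 1) / x := ⟨_, rfl⟩
  have hG0 : 0 < G := by rw [hG]; positivity
  have hGx : G * x = 8 * q ^ 2 * (c * Real.exp 1) := by rw [hG]; field_simp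
  have hGc : c * Real.exp 1 ≤ G := by
    have h1 : c * Real.exp 1 ≤ 8 * q ^ 2 * (c * Real.exp 1) :=
      le_mul_of_one_le_left (by positivity) (by nlinarith)
    nlinarith
  obtain ⟨C₁, hC₁⟩ : ∃ C : ℝ, C = Cτ * y₂ * G := ⟨_, rfl⟩
  have hC₁0 : 0 < C₁ := by rw [hC₁]; positivity
  obtain ⟨κ₀, hκ₀⟩ : ∃ κ : ℝ, κ = c' * Cg * g := ⟨_, rfl⟩
  have hκ₀0 : 0 < κ₀ := by rw [hκ₀]; positivity
  have h1x : 0 < 1 - x := by linarith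
  have h1y : 0 < 1 - y₂ * x := by linarith
  have h1z : 0 < 1 - g * (y₂ * x) := by linarith
  -- The two summands bound $Q-1$, $P-1$ and $u$ respectively. In $\mu$, the first entry gives
  -- $\Lambda_nr_n\le x/8$, the second keeps the total growth of $Q$ and $P$ below $q-c=1$, and the
  -- third gives $\sum_n r_n\le\eta$.
  refine ⟨2 * q * κ₀ * C₁ / (1 - g * (y₂ * x)) + c' * G / (1 - x),
    min (min (x / (8 * C₁)) ((1 - y₂ * x) / (2 * q * C₁))) ((1 - x) / G), by positivity,
    by positivity, ?_⟩
  intro γ η hγ d hZd B K hK p T ε hpK hp hε hε1 hε2 hT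
  obtain ⟨T', A, hT', hA, hA0, hAn⟩ :=
    TransInvBanachAlg.exists_band_approx hZ hZd hα₀ (by linarith) hc hε hT
  have hw : ∀ n : ℕ, IsAlgWeight (expWeight c α₀ ((2 : ℝ) ^ n)⁻¹ : ZLat d → ℝ) := fun n =>
    isAlgWeight_expWeight hZ hZd hα₀ le_rfl hc (by positivity)
  have hv : IsAlgWeight (expWeight c' s 0 : ZLat d → ℝ) :=
    isAlgWeight_expWeight hZ hZd hα₀ hs hc' le_rfl
  have hε1' : C₁ * (γ⁻¹ * ε) ≤ x / 8 := by
    have := hε1.trans ((min_le_left _ _).trans (min_le_left _ _))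
    rw [le_div_iff₀ (by positivity)] at this
    linarith
  have hε1'' : 2 * q * C₁ * (γ⁻¹ * ε) ≤ 1 - y₂ * x := by
    have := hε1.trans ((min_le_left _ _).trans (min_le_right _ _))
    rw [le_div_iff₀ (by positivity)] at this
    linarith
  have hη : G * ε / (1 - x) ≤ η := by
    have h1 : ε / ((1 - x) / G) ≤ η := by
      by_cases hη0 : 0 ≤ η
      · rw [div_le_iff₀ (by positivity), mul_comm]
        exact hε2.trans (mul_le_mul_of_nonneg_right (min_le_right _ _) hη0)
      · exfalso
        have : 0 < min (min (x / (8 * C₁)) ((1 - y₂ * x) / (2 * q * C₁))) ((1 - x) / G) := by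
          positivity
        nlinarith
    calc G * ε / (1 - x) = ε / ((1 - x) / G) := by field_simp
      _ ≤ η := h1
  have hΛr : ∀ n : ℕ, γ⁻¹ * Cτ * y₂ ^ (n + 1) * (G * ε * x ^ n) =
      C₁ * (γ⁻¹ * ε) * (y₂ * x) ^ n := fun n => by
    rw [hC₁, pow_succ, mul_pow]
    ring
  have hyn : ∀ n : ℕ, (y₂ * x) ^ n ≤ 1 := fun n => pow_le_one₀ (by positivity) hy1.le
  have hω0 : 0 ≤ C₁ * (γ⁻¹ * ε) := by positivity
  have hωn : ∀ n : ℕ, C₁ * (γ⁻¹ * ε) * (y₂ * x) ^ n ≤ x / 8 := fun n =>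
    (mul_le_of_le_one_right hω0 (hyn n)).trans hε1'
  have hrs : HasSum (fun n : ℕ => G * ε * x ^ n) (G * ε * (1 - x)⁻¹) :=
    (hasSum_geometric_of_lt_one hx0.le hx1).mul_left _
  have hes : HasSum (fun n : ℕ => κ₀ * g ^ n *
      (q * (2 * (γ⁻¹ * Cτ * y₂ ^ (n + 1) * (G * ε * x ^ n)))))
      (2 * q * κ₀ * (C₁ * (γ⁻¹ * ε)) * (1 - g * (y₂ * x))⁻¹) := by
    refine hasSum_of_eq ((hasSum_geometric_of_lt_one (by positivity) hz1).mul_left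
      (2 * q * κ₀ * (C₁ * (γ⁻¹ * ε)))) fun n => ?_
    rw [hΛr, mul_pow g]
    ring
  obtain ⟨Q, P, D, u, hD, hPQ, hQP, had, hQ, hP, hu⟩ :=
    TransInvBanachAlg.exists_reducibility hK hw (c := c) (p := p) (τ := τ) (γ := γ) (η := η)
      (Λ := fun n => γ⁻¹ * Cτ * y₂ ^ (n + 1)) (r := fun n => G * ε * x ^ n)
      (t := fun n => c * Real.exp 1 * x ^ n * ε) (q := q) (T := A)
      (v := expWeight c' s 0) (κ := fun n => κ₀ * g ^ n)
      (fun n k => by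
        refine mul_le_mul_of_nonneg_left (Real.exp_le_exp.2 (mul_le_mul_of_nonneg_right ?_
          (norm_nonneg k))) (mul_nonneg (by linarith) (Real.rpow_nonneg (japanese_pos k).le _))
        exact inv_anti₀ (by positivity) (pow_le_pow_right₀ one_le_two (Nat.le_succ n)))
      (fun n => expWeight_zero _ _ _) hpK hγ hp (fun n => by positivity) (fun n => by positivity)
      (fun n => by positivity)
      (fun n k => by
        have hj := Real.rpow_pos_of_pos (japanese_pos k) α₀
        have h1 := japanese_rpow_le_exp hτ (one_le_pow₀ one_le_two : (1 : ℝ) ≤ 2 ^ (n + 1)) k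
        rw [two_pow_rpow, ← hy₂, ← hCτ] at h1
        have h2 : ‖k‖ ^ τ ≤ japanese k ^ τ :=
          Real.rpow_le_rpow (norm_nonneg k) (le_max_right _ _) hτ
        -- Halving the exponential rate leaves one of two equal factors over, and it is spent on
        -- $|k|^\tau$.
        have h3 : Real.exp (((2 : ℝ) ^ (n + 1))⁻¹ * ‖k‖) * Real.exp (((2 : ℝ) ^ (n + 1))⁻¹ * ‖k‖) =
            Real.exp (((2 : ℝ) ^ n)⁻¹ * ‖k‖) := by
          rw [← Real.exp_add, pow_succ, mul_inv]
          congr 1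
          ring
        simp only [expWeight]
        rw [← h3]
        calc γ⁻¹ * ‖k‖ ^ τ * (c * japanese k ^ α₀ * Real.exp (((2 : ℝ) ^ (n + 1))⁻¹ * ‖k‖))
            ≤ γ⁻¹ * (Cτ * y₂ ^ (n + 1) * Real.exp (((2 : ℝ) ^ (n + 1))⁻¹ * ‖k‖)) *
              (c * japanese k ^ α₀ * Real.exp (((2 : ℝ) ^ (n + 1))⁻¹ * ‖k‖)) := by
              have := h2.trans h1
              gcongr
          _ = _ := by ring)
      (hA0.trans (ENNReal.ofReal_le_ofReal (by
        simpa using mul_le_mul_of_nonneg_right hGc hε)))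
      (by
        rw [hx]
        exact hAn)
      -- The quadratic term and the band term each take at most half of $r_{n+1}$.
      (fun n => by
        rw [hΛr]
        have h1 : 4 * (C₁ * (γ⁻¹ * ε) * (y₂ * x) ^ n) * (G * ε * x ^ n) ≤
            4 * (x / 8) * (G * ε * x ^ n) :=
          mul_le_mul_of_nonneg_right (by linarith [hωn n]) (by positivity)
        have h2 : 4 * q ^ 2 * (c * Real.exp 1 * x ^ n * ε) = G * x / 2 * (x ^ n * ε) := by
          rw [hGx]
          ring
        rw [h2, pow_succ]
        linarith)
      (fun n => by
        rw [hΛr]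
        linarith [hωn n])
      (by linarith) hq0.le
      (fun n => by
        have h1 : ∑ m ∈ Finset.range n, q * (2 * (γ⁻¹ * Cτ * y₂ ^ (m + 1) * (G * ε * x ^ m))) ≤
            2 * q * (C₁ * (γ⁻¹ * ε)) * (1 - y₂ * x)⁻¹ := by
          have h2 : HasSum (fun m : ℕ =>
              q * (2 * (γ⁻¹ * Cτ * y₂ ^ (m + 1) * (G * ε * x ^ m))))
              (2 * q * (C₁ * (γ⁻¹ * ε)) * (1 - y₂ * x)⁻¹) := by
            refine hasSum_of_eq ((hasSum_geometric_of_lt_one (by positivity) hy1).mul_left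
              (2 * q * (C₁ * (γ⁻¹ * ε)))) fun m => ?_
            rw [hΛr]
            ring
          exact sum_le_hasSum _ (fun m _ => by positivity) h2
        have h3 : 2 * q * (C₁ * (γ⁻¹ * ε)) * (1 - y₂ * x)⁻¹ ≤ 1 := by
          rw [← div_eq_mul_inv, div_le_one h1y]
          linarith
        linarith)
      hrs.summable (by rw [hrs.tsum_eq, ← div_eq_mul_inv]; exact hη) hA hv
      (fun n => by positivity)
      (fun n k => by
        have hj := Real.rpow_pos_of_pos (japanese_pos k) α₀
        have h1 := japanese_rpow_le_exp (sub_nonneg.2 hs)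
          (one_le_pow₀ one_le_two : (1 : ℝ) ≤ 2 ^ (n + 1)) k
        rw [two_pow_rpow, ← hg, ← hCg] at h1
        have h2 : japanese k ^ s = japanese k ^ α₀ * japanese k ^ (s - α₀) := by
          rw [← Real.rpow_add (japanese_pos k), add_sub_cancel]
        simp only [expWeight, zero_mul, Real.exp_zero, mul_one]
        rw [h2, hκ₀]
        calc c' * (japanese k ^ α₀ * japanese k ^ (s - α₀))
            ≤ c' * (japanese k ^ α₀ *
              (Cg * g ^ (n + 1) * Real.exp (((2 : ℝ) ^ (n + 1))⁻¹ * ‖k‖))) := by gcongr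
          _ = c' * Cg * g * g ^ n *
              (1 * japanese k ^ α₀ * Real.exp (((2 : ℝ) ^ (n + 1))⁻¹ * ‖k‖)) := by
            rw [pow_succ]
            ring
          _ ≤ _ := by gcongr)
      hes.summable
  rw [hes.tsum_eq] at hQ hP
  rw [hrs.tsum_eq, expWeight_zero] at hu
  have hbd : 2 * q * κ₀ * (C₁ * (γ⁻¹ * ε)) * (1 - g * (y₂ * x))⁻¹ ≤
      (2 * q * κ₀ * C₁ / (1 - g * (y₂ * x)) + c' * G / (1 - x)) * (γ⁻¹ * ε) := by
    have h1 : 0 ≤ c' * G / (1 - x) * (γ⁻¹ * ε) := by positivity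
    rw [add_mul]
    refine le_add_of_le_of_nonneg (le_of_eq ?_) h1
    rw [div_eq_mul_inv]
    ring
  refine ⟨Q, P, D, T', u, hT', hD, hPQ, hQP, had, hQ.trans (ENNReal.ofReal_le_ofReal hbd),
    hP.trans (ENNReal.ofReal_le_ofReal hbd), hu.trans (ENNReal.ofReal_le_ofReal ?_)⟩
  have h1 : 0 ≤ 2 * q * κ₀ * C₁ / (1 - g * (y₂ * x)) * ε := by positivity
  rw [add_mul]
  refine le_add_of_nonneg_of_le h1 (le_of_eq ?_)
  rw [div_eq_mul_inv]
  ring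

/-! ### Real sequences and inverse square roots in the Banach algebra -/

namespace TransInvBanachAlg

variable {d : ℕ} {B : TransInvBanachAlg d}

/-- The real numbers as a subfield of the complex numbers. -/
noncomputable def realSubfield : Subfield ℂ := Complex.ofRealHom.fieldRange

theorem ofReal_mem_realSubfield (x : ℝ) : (x : ℂ) ∈ realSubfield := ⟨x, rfl⟩

theorem mem_realSubfield {z : ℂ} : z ∈ realSubfield ↔ z.im = 0 := by
  refine ⟨?_, fun h => ⟨z.re, Complex.ext (by simp) (by simp [h])⟩⟩
  rintro ⟨x, rfl⟩
  simp

theorem isClosed_realSubfield : IsClosed (realSubfield : Set ℂ) := by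
  have : (realSubfield : Set ℂ) = {z | z.im = 0} := by
    ext z
    exact mem_realSubfield
  rw [this]
  exact isClosed_eq Complex.continuous_im continuous_const

theorem bnorm_const_mul_le {K : Subfield ℂ} {c : ℂ} (hc : c ∈ K) (a : ZLat d → ℂ) :
    B.bnorm K (fun i => c * a i) ≤ ‖c‖ₑ * B.bnorm K a := by
  have hmem : (fun _ : ZLat d => c) ∈ B.carrier := by
    have := B.carrier.algebraMap_mem c
    exact this
  have h : B.bnorm K (fun _ => c) = ‖c‖ₑ := by
    rw [bnorm_eq hmem fun _ => hc, B.seqNorm_of_mem hmem]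
    have e : (⟨fun _ => c, hmem⟩ : B.carrier) = c • (1 : B.carrier) := by
      apply Subtype.ext
      funext i
      simp
    rw [e, map_smul_eq_mul, B.norm_one, mul_one, ofReal_norm]
  rw [← h]
  exact bnorm_mul_le (fun _ => c) a

/-- Power series with zero constant term and coefficients of modulus at most `c` act on the
real sequences of small norm. -/
theorem bnorm_powerSeries_le {a : ℕ → ℝ} {c x : ℝ} (ha : ∀ n, |a n| ≤ c)
    (hx0 : 0 ≤ x) (hx : x ≤ 1 / 2) {ξ ζ : ZLat d → ℝ}
    (hξ : B.bnorm realSubfield (fun i => (ξ i : ℂ)) ≤ ENNReal.ofReal x)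
    (hζ : ∀ i, HasSum (fun n => a n * ξ i ^ (n + 1)) (ζ i)) :
    B.bnorm realSubfield (fun i => (ζ i : ℂ)) ≤ ENNReal.ofReal (2 * c * x) := by
  have hc : 0 ≤ c := (abs_nonneg _).trans (ha 0)
  have h : ∀ i, HasSum (fun n => ((a n : ℝ) : ℂ) * ((fun i => (ξ i : ℂ)) ^ (n + 1) : ZLat d → ℂ) i)
      (ζ i : ℂ) := fun i => by
    refine hasSum_of_eq (Complex.hasSum_ofReal.2 (hζ i)) fun n => ?_
    push_cast
    rfl
  refine (bnorm_le_tsum isClosed_realSubfield h).trans ?_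
  have hs : HasSum (fun n : ℕ => c * x ^ (n + 1)) (c * (x * (1 - x)⁻¹)) := by
    simpa only [pow_succ'] using
      ((hasSum_geometric_of_lt_one hx0 (by linarith)).mul_left x).mul_left c
  have hle : ∀ n, B.bnorm realSubfield (fun i => ((a n : ℝ) : ℂ) *
      ((fun i => (ξ i : ℂ)) ^ (n + 1) : ZLat d → ℂ) i) ≤ ENNReal.ofReal (c * x ^ (n + 1)) := by
    intro n
    refine (bnorm_const_mul_le (ofReal_mem_realSubfield _) _).trans ?_
    rw [ENNReal.ofReal_mul hc]
    refine mul_le_mul' ?_ ?_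
    · rw [← ofReal_norm, Complex.norm_real]
      exact ENNReal.ofReal_le_ofReal (ha n)
    · rw [ENNReal.ofReal_pow hx0]
      exact (bnorm_pow_le _ _).trans (pow_le_pow_left' hξ _)
  refine (ENNReal.tsum_le_tsum hle).trans ?_
  rw [← ENNReal.ofReal_tsum_of_nonneg (fun n => by positivity) hs.summable, hs.tsum_eq]
  refine ENNReal.ofReal_le_ofReal ?_
  have h1 : (1 - x)⁻¹ ≤ 2 := by
    rw [inv_le_comm₀ (by linarith) two_pos]
    linarith
  calc c * (x * (1 - x)⁻¹) ≤ c * (x * 2) := by gcongr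
    _ = 2 * c * x := by ring

/-- Inverse square roots of real sequences close to `1`. -/
theorem bnorm_exp_log_sub_one_le {x : ℝ} (hx0 : 0 ≤ x) (hx : x ≤ 1 / 2) {ξ : ZLat d → ℝ}
    (hξ : B.bnorm realSubfield (fun i => (ξ i : ℂ)) ≤ ENNReal.ofReal x) :
    B.bnorm realSubfield
      (fun i => ((Real.exp (-(1 / 2) * Real.log (1 + ξ i)) - 1 : ℝ) : ℂ)) ≤
      ENNReal.ofReal (2 * x) := by
  have habs : ∀ i, |ξ i| < 1 := fun i => by
    have h := (enorm_apply_le_bnorm (B := B) (K := realSubfield) (fun i => (ξ i : ℂ)) i).trans hξ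
    rw [← ofReal_norm, ENNReal.ofReal_le_ofReal_iff hx0, Complex.norm_real, Real.norm_eq_abs] at h
    linarith
  -- Going through $\exp(-\tfrac12\log(1+\xi))$ uses two series with obvious coefficient bounds. The
  -- bound $1/2$ for the logarithm reproduces $x\le1/2$, so the exponential series applies with the
  -- same $x$.
  have hlog : B.bnorm realSubfield
      (fun i => ((-(1 / 2) * Real.log (1 + ξ i) : ℝ) : ℂ)) ≤ ENNReal.ofReal (2 * (1 / 2) * x) := by
    refine bnorm_powerSeries_le (a := fun n => (1 / 2) * ((-1) ^ (n + 1) / (n + 1))) (fun n => ?_)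
      hx0 hx hξ fun i => ?_
    · rw [abs_mul, abs_of_pos (by norm_num : (0 : ℝ) < 1 / 2), abs_div, abs_pow, abs_neg, abs_one,
        one_pow]
      have : (1 : ℝ) ≤ |(n : ℝ) + 1| := by
        rw [abs_of_nonneg (by positivity)]
        linarith [(Nat.cast_nonneg n : (0 : ℝ) ≤ n)]
      have := div_le_one_of_le₀ this (abs_nonneg _)
      linarith
    · have h := (Real.hasSum_pow_div_log_of_abs_lt_one
        (x := -ξ i) (by rw [abs_neg]; exact habs i)).mul_left (1 / 2)
      rw [sub_neg_eq_add, mul_neg, ← neg_mul] at h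
      refine hasSum_of_eq h fun n => ?_
      rw [neg_pow]
      ring
  rw [mul_one_div_cancel two_ne_zero, one_mul] at hlog
  have := bnorm_powerSeries_le (a := fun n => 1 / ((n + 1).factorial : ℝ)) (c := 1) (fun n => ?_)
      hx0 hx hlog (ζ := fun i => Real.exp (-(1 / 2) * Real.log (1 + ξ i)) - 1) fun i => ?_
  · simpa using this
  · rw [abs_of_nonneg (by positivity)]
    refine div_le_one_of_le₀ ?_ (by positivity)
    exact_mod_cast Nat.succ_le_of_lt (Nat.factorial_pos _)
  · have h := NormedSpace.expSeries_div_hasSum_exp (-(1 / 2) * Real.log (1 + ξ i))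
    rw [← Real.exp_eq_exp_ℝ, ← hasSum_nat_add_iff' 1] at h
    simp only [Finset.sum_range_one, pow_zero, Nat.factorial_zero, Nat.cast_one, div_one] at h
    refine hasSum_of_eq h fun n => ?_
    ring

end TransInvBanachAlg

/-! ### Transposes and unitarity on $\ell^2$ -/

namespace LatOp

variable {d : ℕ}

theorem ent_mul_transpose {A C A' C' : LatOp d} (hA : A'.ent = A.entᵀ) (hC : C'.ent = C.entᵀ) :
    (C' * A').ent = (A * C).entᵀ := by
  ext i j
  refine (hasSum_ent_mul C' A' i j).unique ?_
  refine hasSum_of_eq (hasSum_ent_mul A C j i) fun k => ?_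
  rw [hA, hC, Matrix.transpose_apply, Matrix.transpose_apply, mul_comm]

theorem IsAd.transpose {p : ZLat d → ℂ} {A C A' C' : LatOp d} (h : IsAd p A C)
    (hA : A'.ent = A.entᵀ) (hC : C'.ent = C.entᵀ) : IsAd p A' (-C') := fun i j => by
  rw [ent_neg, hA, hC, Matrix.neg_apply, Matrix.transpose_apply, Matrix.transpose_apply, ← h j i]
  ring

/-- An operator on `ℓ¹` whose inverse is given by the conjugate transpose matrix defines a unitary
operator on `ℓ²`. -/
theorem isUnitaryMat {U V : LatOp d} (hVU : V * U = 1) (hUV : U * V = 1)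
    (hV : V.ent = U.entᴴ) : IsUnitaryMat U.ent := by
  have hmem : ∀ j, Memℓp (fun i => U.ent i j) 2 := fun j => by
    refine Memℓp.of_exponent_ge (q := 1) (memℓp_gen ?_) one_le_two
    simpa using summable_norm_col U j
  let b : ZLat d → lp (fun _ : ZLat d => ℂ) 2 := fun j => ⟨fun i => U.ent i j, hmem j⟩
  have hinner : ∀ j (x : lp (fun _ : ZLat d => ℂ) 2),
      HasSum (fun k => V.ent j k * x k) (inner ℂ (b j) x) := fun j x => by
    refine hasSum_of_eq (lp.hasSum_inner (𝕜 := ℂ) (b j) x) fun k => ?_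
    rw [hV, Matrix.conjTranspose_apply, RCLike.inner_apply, mul_comm]
    rfl
  have hort : Orthonormal ℂ b := by
    rw [orthonormal_iff_ite]
    intro i j
    have h := (hinner i (b j)).unique (hasSum_ent_mul V U i j)
    rw [h, hVU, ent_one, Matrix.one_apply]
  -- A vector $x$ orthogonal to all columns of $U$ satisfies $Vx=0$, hence $x=(UV)x=U(Vx)=0$ once
  -- the double series may be reordered. Since $V=U^*$, rows of $U$ are summable as columns of $V$,
  -- which justifies this for $x\in\ell^2$.
  have hcomplete : (Submodule.span ℂ (Set.range b))ᗮ = ⊥ := by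
    rw [Submodule.eq_bot_iff]
    intro x hx
    have hz : ∀ j, HasSum (fun k => V.ent j k * x k) 0 := fun j => by
      have h0 : inner ℂ (b j) x = 0 :=
        (Submodule.mem_orthogonal _ _).1 hx (b j) (Submodule.subset_span ⟨j, rfl⟩)
      rw [← h0]
      exact hinner j x
    have hVn : ∀ j k, ‖V.ent j k‖ = ‖U.ent k j‖ := fun j k => by
      rw [hV, Matrix.conjTranspose_apply, norm_star]
    ext l
    have hsm : Summable fun jk : ZLat d × ZLat d => U.ent l jk.1 * (V.ent jk.1 jk.2 * x jk.2) := by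
      refine Summable.of_norm ?_
      have hle : ∀ jk : ZLat d × ZLat d, ‖U.ent l jk.1 * (V.ent jk.1 jk.2 * x jk.2)‖ ≤
          ‖V.ent jk.1 l‖ * (‖U.ent jk.2 jk.1‖ * ‖x‖) := fun jk => by
        rw [norm_mul, norm_mul, ← hVn jk.1 l, ← hVn jk.1 jk.2]
        gcongr
        exact lp.norm_apply_le_norm two_ne_zero x _
      have hcol : ∀ j, Summable fun k => ‖V.ent j l‖ * (‖U.ent k j‖ * ‖x‖) := fun j =>
        ((summable_norm_col U j).mul_right _).mul_left _
      refine Summable.of_nonneg_of_le (fun _ => norm_nonneg _) hle ?_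
      refine (summable_prod_of_nonneg fun _ => by positivity).2 ⟨hcol, ?_⟩
      refine Summable.of_nonneg_of_le (fun _ => tsum_nonneg fun _ => by positivity) (fun j => ?_)
        ((summable_norm_col V l).mul_right (‖U‖ * ‖x‖))
      dsimp only
      rw [tsum_mul_left, tsum_mul_right]
      gcongr
      exact tsum_norm_col_le U j
    have h1 := hsm.hasSum.prod_fiberwise fun j => (hz j).mul_left (U.ent l j)
    simp only [mul_zero] at h1
    have hsm' := (Equiv.prodComm (ZLat d) (ZLat d)).summable_iff.2 hsm
    have hsum' := (Equiv.prodComm (ZLat d) (ZLat d)).hasSum_iff.2 hsm.hasSum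
    have h2 := hsum'.prod_fiberwise (g := fun k => (1 : LatMat d) l k * x k) fun k => by
      rw [← ent_one, ← hUV]
      refine hasSum_of_eq ((hasSum_ent_mul U V l k).mul_right (x k)) fun j => ?_
      simp [mul_assoc]
    have h3 : HasSum (fun k => (1 : LatMat d) l k * x k) (x l) := by
      convert hasSum_single l ?_ using 1
      · simp
      · intro k hk
        rw [Matrix.one_apply_ne hk.symm, zero_mul]
    have h4 := h3.unique h2
    rw [h4]
    exact h1.unique hasSum_zero
  refine ⟨(HilbertBasis.mkOfOrthogonalEqBot hort hcomplete).repr.symm, fun i j => ?_⟩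
  rw [HilbertBasis.repr_symm_single, HilbertBasis.coe_mkOfOrthogonalEqBot]

end LatOp

/-! ### The unitary polar part for real symmetric data -/

namespace TransInvBanachAlg

variable {d : ℕ} {B : TransInvBanachAlg d}

/-- For real symmetric data the diagonalizing matrix can be replaced by its unitary polar part:
its Gram matrix commutes with a diagonal matrix with distinct entries, hence is diagonal. -/
theorem exists_unitary_reducibility {v : ZLat d → ℝ} (hv : IsAlgWeight v) {p u : ZLat d → ℂ}
    (hpu : ∀ i j, i ≠ j → p i + u i - (p j + u j) ≠ 0) {Q P D T : LatOp d}
    (hD : D.ent = Matrix.diagonal u) (hQP : Q * P = 1)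
    (had : LatOp.IsAd p Q (Q * D - T * Q)) (hT : T.entᵀ = T.ent) {θ : ℝ} (hθ0 : 0 ≤ θ)
    (hθ : θ ≤ 1 / 6) (hQ : B.wnorm realSubfield v (Q - 1).ent ≤ ENNReal.ofReal θ) :
    ∃ G S U : LatOp d, IsProd Q.entᵀ Q.ent G.ent ∧ IsInvSqrt G.ent S.ent ∧
      IsProd Q.ent S.ent U.ent ∧ IsUnitaryMat U.ent ∧ IsMatInv U.ent U.entᴴ ∧
      IsTripleProd U.entᴴ (T.ent + Matrix.diagonal p) U.ent (Matrix.diagonal p + D.ent) ∧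
      B.wnorm realSubfield v (S - 1).ent ≤ ENNReal.ofReal (6 * v 0 * θ) ∧
      B.wnorm realSubfield v (U - 1).ent ≤ ENNReal.ofReal (13 * v 0 * θ) := by
  have hK := isClosed_realSubfield
  have hv0 : 1 ≤ v 0 := by
    have := hv.one_le 0
    rwa [ENNReal.one_le_ofReal] at this
  set X := Q - 1 with hX
  have hQX : Q = 1 + X := by rw [hX]; abel
  have hXt : B.wnorm realSubfield v X.entᵀ ≤ ENNReal.ofReal θ := by rwa [wnorm_transpose hv.even]
  obtain ⟨Xt, hXte, -⟩ := exists_ent_eq_of_wnorm hv (ne_top_of_le_ne_top ENNReal.ofReal_ne_top hXt)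
  rw [← hXte] at hXt
  set Qt := 1 + Xt with hQt
  have hQte : Qt.ent = Q.entᵀ := by
    rw [hQt, hQX, LatOp.ent_add, LatOp.ent_add, hXte, LatOp.ent_one, Matrix.transpose_add,
      Matrix.transpose_one]
  have hDt : D.ent = D.entᵀ := by rw [hD, Matrix.diagonal_transpose]
  have hadt : LatOp.IsAd p Qt (-(D * Qt - Qt * T)) := by
    refine had.transpose hQte ?_
    rw [LatOp.ent_sub, LatOp.ent_sub, Matrix.transpose_sub, LatOp.ent_mul_transpose hQte hDt,
      LatOp.ent_mul_transpose hT.symm hQte]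
  -- In the Leibniz rule the two terms $Q^tTQ$ cancel because $T$ is symmetric, so $Q^tQ$ commutes
  -- with $p+u$.
  have hadG : LatOp.IsAd p (Qt * Q) (Qt * Q * D - D * (Qt * Q)) := by
    have h := hadt.mul had
    have e : -(D * Qt - Qt * T) * Q + Qt * (Q * D - T * Q) = Qt * Q * D - D * (Qt * Q) := by
      noncomm_ring
    rwa [e] at h
  set G := Qt * Q with hG
  have hG1 : B.wnorm realSubfield v (G - 1).ent ≤ ENNReal.ofReal (3 * θ) := by
    have e : G - 1 = Xt * X + (Xt + X) := by
      rw [hG, hQt, hQX]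
      noncomm_ring
    rw [e]
    refine (wnorm_add_le_ofReal (by positivity) (by positivity)
      (wnorm_mul_le_ofReal hK hv hθ0 hXt hQ)
      (wnorm_add_le_ofReal hθ0 hθ0 hXt hQ)).trans (ENNReal.ofReal_le_ofReal ?_)
    nlinarith
  have hGn := (bnorm_diag_le hv (G - 1).ent).trans hG1
  have hGreal := (bnorm_ne_top_iff.1 (ne_top_of_le_ne_top ENNReal.ofReal_ne_top hGn)).2
  choose ξ hξ using hGreal
  have hξ' : ∀ i, (ξ i : ℂ) = (G - 1).ent i i := hξ
  have hGe : G.ent = Matrix.diagonal fun i => 1 + (ξ i : ℂ) := by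
    ext i j
    by_cases hij : i = j
    · subst hij
      rw [Matrix.diagonal_apply_eq, hξ', LatOp.ent_sub, LatOp.ent_one]
      simp
    · rw [Matrix.diagonal_apply_ne _ hij]
      have h := hadG i j
      rw [LatOp.ent_sub, Matrix.sub_apply, LatOp.ent_mul_diagonal hD,
        LatOp.ent_diagonal_mul hD] at h
      have h2 : (p i + u i - (p j + u j)) * G.ent i j = 0 := by linear_combination h
      exact (mul_eq_zero.1 h2).resolve_left (hpu i j hij)
  have hξn : B.bnorm realSubfield (fun i => (ξ i : ℂ)) ≤ ENNReal.ofReal (3 * θ) := by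
    simp only [hξ']
    exact hGn
  have hξ1 : ∀ i, 0 < 1 + ξ i := fun i => by
    have h := (enorm_apply_le_bnorm (B := B) (K := realSubfield) (fun i => (ξ i : ℂ)) i).trans hξn
    rw [← ofReal_norm, ENNReal.ofReal_le_ofReal_iff (by positivity), Complex.norm_real,
      Real.norm_eq_abs] at h
    linarith [neg_abs_le (ξ i)]
  let σ : ZLat d → ℝ := fun i => Real.exp (-(1 / 2) * Real.log (1 + ξ i))
  have hσ : ∀ i, (1 + ξ i) * (σ i * σ i) = 1 := fun i => by
    have : σ i * σ i = Real.exp (-Real.log (1 + ξ i)) := by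
      simp only [σ]
      rw [← Real.exp_add]
      congr 1
      ring
    rw [this, Real.exp_neg, Real.exp_log (hξ1 i), mul_inv_cancel₀ (hξ1 i).ne']
  have hσ' : ∀ i, (1 + (ξ i : ℂ)) * (σ i * σ i) = 1 := fun i => by exact_mod_cast hσ i
  -- The bound $\theta\le1/6$ enters here: the series need $3\theta\le1/2$.
  have hyn := bnorm_exp_log_sub_one_le (B := B) (by positivity) (by linarith) hξn
  have hYn : B.wnorm realSubfield v (Matrix.diagonal fun i => ((σ i - 1 : ℝ) : ℂ)) ≤
      ENNReal.ofReal (6 * v 0 * θ) := by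
    rw [wnorm_diagonal]
    refine (mul_le_mul' hyn le_rfl).trans ?_
    rw [← ENNReal.ofReal_mul (by positivity)]
    exact ENNReal.ofReal_le_ofReal (by linarith)
  obtain ⟨Y, hY, -⟩ := exists_ent_eq_of_wnorm hv (ne_top_of_le_ne_top ENNReal.ofReal_ne_top hYn)
  rw [← hY] at hYn
  set S := 1 + Y with hS
  have hSe : S.ent = Matrix.diagonal fun i => (σ i : ℂ) := by
    rw [hS, LatOp.ent_add, LatOp.ent_one, hY, ← Matrix.diagonal_one, Matrix.diagonal_add]
    congr 1
    funext i
    push_cast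
    ring
  have hent : ∀ {A : LatOp d}, (∀ i j, A.ent i j = (1 : LatMat d) i j) → A = 1 := fun h =>
    LatOp.ent_injective (by rw [LatOp.ent_one]; ext i j; exact h i j)
  have hGSS : G * (S * S) = 1 := hent fun i j => by
    rw [LatOp.ent_diagonal_mul hGe, LatOp.ent_mul_diagonal hSe, hSe]
    by_cases hij : i = j
    · subst hij
      rw [Matrix.diagonal_apply_eq, hσ', Matrix.one_apply_eq]
    · simp [hij]
  have hSSG : S * S * G = 1 := hent fun i j => by
    rw [LatOp.ent_mul_diagonal hGe, LatOp.ent_mul_diagonal hSe, hSe]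
    by_cases hij : i = j
    · subst hij
      rw [Matrix.diagonal_apply_eq, mul_comm, hσ', Matrix.one_apply_eq]
    · simp [hij]
  have hcomm : ∀ {A : LatOp d} {a : ZLat d → ℂ}, A.ent = Matrix.diagonal a → A * S = S * A :=
    fun h => LatOp.ent_injective (by
      ext i j
      rw [LatOp.ent_mul_diagonal hSe, LatOp.ent_diagonal_mul hSe, h]
      by_cases hij : i = j
      · subst hij
        ring
      · simp [hij])
  have hSte : S.ent = S.entᵀ := by rw [hSe, Matrix.diagonal_transpose]
  set U := Q * S with hU
  set Ut := S * Qt with hUt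
  have hUtU : Ut * U = 1 := by
    calc Ut * U = S * (Qt * Q) * S := by rw [hUt, hU]; noncomm_ring
      _ = S * (S * G) := by rw [← hG, mul_assoc, hcomm hGe]
      _ = 1 := by rw [← mul_assoc, hSSG]
  -- In infinite dimensions the left inverse does not suffice; $P$ supplies a right inverse $SGP$,
  -- which must agree with it.
  have hUUt : U * Ut = 1 := by
    have h1 : U * (S * G * P) = 1 := by
      calc U * (S * G * P) = Q * (S * S * G) * P := by rw [hU]; noncomm_ring
        _ = 1 := by rw [hSSG, mul_one, hQP]
    rwa [← left_inv_eq_right_inv hUtU h1] at h1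
  have hXn : B.wnorm realSubfield v (U - 1).ent ≤ ENNReal.ofReal (13 * v 0 * θ) := by
    have e : U - 1 = X * Y + (X + Y) := by
      rw [hU, hQX, hS]
      noncomm_ring
    have hθv : 0 ≤ 6 * v 0 * θ := by positivity
    rw [e]
    refine (wnorm_add_le_ofReal (by positivity) (by positivity)
      (wnorm_mul_le_ofReal hK hv hθ0 hQ hYn)
      (wnorm_add_le_ofReal hθ0 hθv hQ hYn)).trans (ENNReal.ofReal_le_ofReal ?_)
    nlinarith
  -- Finiteness of the extended norm over $\mathbb R$ forces real entries; hence the transpose is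
  -- the adjoint.
  have hUreal : ∀ i j, U.ent i j ∈ realSubfield := fun i j => by
    have hXfin : B.wnorm realSubfield v (U - 1).ent ≠ ⊤ :=
      ne_top_of_le_ne_top ENNReal.ofReal_ne_top hXn
    have hk : B.bnorm realSubfield (kDiag (U - 1).ent (i - j)) ≠ ⊤ := fun htop => by
      have h1 := le_ellTwo (fun k => B.bnorm realSubfield (kDiag (U - 1).ent k) *
        ENNReal.ofReal (v k)) (i - j)
      rw [htop, ENNReal.top_mul (ENNReal.ofReal_pos.2 (hv.pos _)).ne', top_le_iff] at h1
      exact hXfin h1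
    have h2 := (bnorm_ne_top_iff.1 hk).2 i
    simp only [kDiag, sub_sub_cancel] at h2
    rw [LatOp.ent_sub, LatOp.ent_one, Matrix.sub_apply] at h2
    have h3 : (1 : LatMat d) i j ∈ realSubfield := by
      rw [Matrix.one_apply]
      split_ifs
      · exact one_mem _
      · exact zero_mem _
    simpa using add_mem h2 h3
  have hUte : Ut.ent = U.entᴴ := by
    rw [hUt, hU, LatOp.ent_mul_transpose hQte hSte]
    ext i j
    rw [Matrix.transpose_apply, Matrix.conjTranspose_apply]
    exact (Complex.conj_eq_iff_im.2 (mem_realSubfield.1 (hUreal j i))).symm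
  refine ⟨G, S, U, ?_, ⟨?_, (S * S).ent, S.isProd S, ?_, ?_⟩, Q.isProd S,
    LatOp.isUnitaryMat hUtU hUUt hUte, ⟨?_, ?_⟩, ?_, ?_, hXn⟩
  · rw [← hQte]
    exact Qt.isProd Q
  · rw [hSe]
    refine Matrix.PosSemidef.diagonal fun i => ?_
    exact Complex.zero_le_real.2 (Real.exp_pos _).le
  · rw [← LatOp.ent_one, ← hGSS]
    exact G.isProd _
  · rw [← LatOp.ent_one, ← hSSG]
    exact (S * S).isProd G
  · rw [← hUte, ← LatOp.ent_one, ← hUUt]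
    exact U.isProd Ut
  · rw [← hUte, ← LatOp.ent_one, ← hUtU]
    exact Ut.isProd U
  · rw [← hUte]
    refine LatOp.isTripleProd_of_isAd hUtU ?_
    have h := had.mul (LatOp.isAd_of_diagonal (p := p) hSe)
    have e : (Q * D - T * Q) * S + Q * 0 = U * D - T * U := by
      rw [hU, mul_zero, add_zero, sub_mul, mul_assoc Q D S, hcomm hD, mul_assoc, mul_assoc]
    rwa [e] at h
  · have e : S - 1 = Y := by rw [hS]; abel
    rwa [e]

theorem wnorm_japanese_diagonal {K : Subfield ℂ} (s : ℝ) (u : ZLat d → ℂ) :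
    B.wnorm K (fun k => japanese k ^ s) (Matrix.diagonal u) = B.bnorm K u := by
  rw [wnorm_diagonal]
  simp [japanese]

/-- All Sobolev norms of a diagonal matrix coincide, because $\langle 0\rangle=1$. -/
theorem memDiagInf_diagonal {K : Subfield ℂ} {u : ZLat d → ℂ} {x : ℝ} (hx : 0 ≤ x)
    (h : B.bnorm K u ≤ ENNReal.ofReal x) :
    B.MemDiagInf (Matrix.diagonal u) ∧ B.sobNorm 0 (Matrix.diagonal u) ≤ x := by
  have key : ∀ s : ℝ, B.MemSob s (Matrix.diagonal u) ∧ B.sobNorm s (Matrix.diagonal u) ≤ x :=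
    fun s => memSob_and_sobNorm_le hx (K := K) (by rwa [wnorm_japanese_diagonal])
  exact ⟨⟨fun s _ => (key s).1, by simp⟩, (key 0).2⟩

/-- Transfer of the estimates of an operator close to the identity to Sobolev norms. -/
theorem memSob_and_sobNorm_sub_one_le {K : Subfield ℂ} {c s x : ℝ} (hc : 1 ≤ c) (hx : 0 ≤ x)
    {A : LatOp d} (h : B.wnorm K (expWeight c s 0) (A - 1).ent ≤ ENNReal.ofReal x) :
    B.MemSob s A.ent ∧ B.sobNorm s (A.ent - 1) ≤ x := by
  have h1 : B.wnorm K (fun k => japanese k ^ s) (A - 1).ent ≤ ENNReal.ofReal x := by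
    refine (wnorm_mono (fun k => ?_) _).trans h
    have := Real.rpow_nonneg (japanese_pos k).le s
    simp only [expWeight, zero_mul, Real.exp_zero, mul_one]
    nlinarith
  have h2 := wnorm_add_le (B := B) (K := K) (fun k => japanese k ^ s) (A - 1).ent (1 : LatOp d).ent
  rw [← LatOp.ent_add, sub_add_cancel] at h2
  have h3 : B.wnorm K (fun k => japanese k ^ s) A.ent ≠ ⊤ := by
    refine ne_top_of_le_ne_top (ENNReal.add_ne_top.2
      ⟨ne_top_of_le_ne_top ENNReal.ofReal_ne_top h1, ?_⟩) h2
    rw [LatOp.ent_one, wnorm_one]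
    exact ENNReal.ofReal_ne_top
  rw [LatOp.ent_sub, LatOp.ent_one] at h1
  exact ⟨(memSob_of_wnorm h3).1, (memSob_and_sobNorm_le hx h1).2⟩

end TransInvBanachAlg

/-! ### Conclusion -/

/-- Spending a power of $\epsilon$ removes $\gamma^{-1}$, so that $\gamma$ affects only the
smallness threshold and not the constant. -/
theorem inv_mul_le_rpow {γ ε κ : ℝ} (hγ : 0 < γ) (hε : 0 ≤ ε) (hκ : κ < 1)
    (h : ε ≤ γ ^ (1 / (1 - κ))) : γ⁻¹ * ε ≤ ε ^ κ := by
  rcases hε.eq_or_lt with rfl | hε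
  · rw [mul_zero]
    exact Real.rpow_nonneg le_rfl _
  · have h1 : ε ^ (1 - κ) ≤ γ := by
      have := Real.rpow_le_rpow hε.le h (by linarith : 0 ≤ 1 - κ)
      rwa [← Real.rpow_mul hγ.le, one_div_mul_cancel (by linarith), Real.rpow_one] at this
    have h2 : ε = ε ^ κ * ε ^ (1 - κ) := by
      rw [← Real.rpow_add hε, add_sub_cancel, Real.rpow_one]
    rw [inv_mul_le_iff₀ hγ]
    calc ε = ε ^ κ * ε ^ (1 - κ) := h2
      _ ≤ ε ^ κ * γ := by gcongr
      _ = γ * ε ^ κ := mul_comm _ _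

theorem theorem2p2 (δ α₀ τ α : ℝ) (hδ : 0 < δ) (hτ : 0 < τ) (hα : α₀ + τ + 7 * δ < α) :
    ∃ C : ℝ, 0 < C ∧ ∀ γ η : ℝ, 0 < γ → 0 < η → ∃ ε₀ : ℝ, 0 < ε₀ ∧
      ∀ (d : ℕ), (d : ℝ) / 2 < α₀ → ∀ (B : TransInvBanachAlg d) (p : ZLat d → ℂ) (T : LatMat d),
        (∀ D' : LatMat d, B.MemDiagInf D' → B.sobNorm 0 D' ≤ η →
          B.Distal τ γ (fun i => p i + D' i i)) →
        B.MemSob (α + 4 * δ) T →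
        B.sobNorm (α + 4 * δ) T ≤ ε₀ →
        ∃ Q Qinv Dp : LatMat d,
          B.MemSob (α - τ - 7 * δ) Q ∧ B.MemSob (α - τ - 7 * δ) Qinv ∧ IsMatInv Q Qinv ∧
          B.MemDiagInf Dp ∧
          IsTripleProd Qinv (T + Matrix.diagonal p) Q (Matrix.diagonal p + Dp) ∧
          B.sobNorm (α - τ - 7 * δ) (Q - 1)
            ≤ C * B.sobNorm (α + 4 * δ) T ^ (δ / (α - α₀)) ∧
          B.sobNorm (α - τ - 7 * δ) (Qinv - 1)
            ≤ C * B.sobNorm (α + 4 * δ) T ^ (δ / (α - α₀)) ∧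
          B.sobNorm 0 Dp ≤ C * B.sobNorm (α + 4 * δ) T ∧
          (1 ≤ α - α₀ →
            B.sobNorm 0 Dp ≤ C * B.sobNorm (α + 4 * δ) T ^ (1 / (α - α₀))) ∧
          (IsRealSymm T → IsRealSymm (Matrix.diagonal p : LatMat d) →
            ∃ G S U : LatMat d,
              IsProd Qᵀ Q G ∧ B.MemSob (α - τ - 7 * δ) S ∧ IsInvSqrt G S ∧ IsProd Q S U ∧
              B.MemSob (α - τ - 7 * δ) U ∧ IsUnitaryMat U ∧ IsMatInv U Uᴴ ∧
              IsTripleProd Uᴴ (T + Matrix.diagonal p) U (Matrix.diagonal p + Dp) ∧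
              B.sobNorm (α - τ - 7 * δ) (U - 1)
                ≤ C * B.sobNorm (α + 4 * δ) T ^ (δ / (α - α₀))) := by
  by_cases hα₀ : 0 < α₀
  swap
  -- For $\alpha_0\le0$ no dimension satisfies $d/2<\alpha_0$.
  · refine ⟨1, one_pos, fun γ η _ _ => ⟨1, one_pos, fun d hd => ?_⟩⟩
    have : (0 : ℝ) ≤ (d : ℝ) / 2 := by positivity
    linarith
  obtain ⟨Z, hZ, hZd⟩ := exists_tsum_japanese_le α₀
  have hs : α₀ ≤ α - τ - 7 * δ := by linarith
  obtain ⟨C, μ, hC, hμ, hmain⟩ := exists_reducibility_const (b := α + 4 * δ - α₀) hZ hα₀.le hτ.le hs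
    (by linarith) rfl
  set c := 2 ^ (α - τ - 7 * δ + 1) * Z with hc
  have hc1 : 1 ≤ c :=
    one_le_mul_of_one_le_of_one_le (Real.one_le_rpow one_le_two (by linarith)) hZ
  set κ := δ / (α - α₀) with hκ
  have hκ1 : κ < 1 := by
    rw [hκ, div_lt_one (by linarith)]
    linarith
  have hCC : C ≤ 13 * c * C := by nlinarith
  refine ⟨13 * c * C, by positivity, fun γ η hγ hη => ?_⟩
  -- The entries serve, in order: $\epsilon\le\epsilon^{1/(\alpha-\alpha_0)}$; the two smallness
  -- conditions of the scheme; distality of the final $p+u$; $\theta\le1/6$ in the unitary part; and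
  -- the trade of $\gamma^{-1}\epsilon$ for $\epsilon^\kappa$.
  refine ⟨min (min (min 1 (γ * μ)) (min (μ * η) (η / C)))
    (min (γ / (6 * C)) (γ ^ (1 / (1 - κ)))), by positivity, fun d hd B p T hp hT hTε => ?_⟩
  set ε := B.sobNorm (α + 4 * δ) T with hε
  have hε0 : 0 ≤ ε := B.sobNorm_nonneg _ _
  simp only [le_min_iff] at hTε
  obtain ⟨⟨⟨hε1, hεμ⟩, hεη, hεC⟩, hεθ, hεκ⟩ := hTε
  -- Fixing $K$ before the scheme runs lets the same $Q$ and $D$ serve both the general and the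
  -- symmetric conclusions.
  obtain ⟨K, hK, hpK, hTK, hreal⟩ : ∃ K : Subfield ℂ, IsClosed (K : Set ℂ) ∧ (∀ i, p i ∈ K) ∧
      (∀ i j, T i j ∈ K) ∧ (IsRealSymm T → IsRealSymm (Matrix.diagonal p : LatMat d) →
        K = TransInvBanachAlg.realSubfield) := by
    by_cases h : IsRealSymm T ∧ IsRealSymm (Matrix.diagonal p : LatMat d)
    · refine ⟨TransInvBanachAlg.realSubfield, TransInvBanachAlg.isClosed_realSubfield,
        fun i => ?_, fun i j => TransInvBanachAlg.mem_realSubfield.2 (h.1.1 i j),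
        fun _ _ => rfl⟩
      have := h.2.1 i i
      rw [Matrix.diagonal_apply_eq] at this
      exact TransInvBanachAlg.mem_realSubfield.2 this
    · exact ⟨⊤, by simp, fun _ => Subfield.mem_top _, fun _ _ => Subfield.mem_top _,
        fun h1 h2 => (h ⟨h1, h2⟩).elim⟩
  have hp' : ∀ u : ZLat d → ℂ, B.bnorm K u ≤ ENNReal.ofReal η →
      B.Distal τ γ fun i => p i + u i := fun u hu => by
    obtain ⟨h1, h2⟩ := TransInvBanachAlg.memDiagInf_diagonal hη.le hu
    simpa using hp _ h1 h2
  have hTn : B.wnorm K (fun k => japanese k ^ (α₀ + (α + 4 * δ - α₀))) T ≤ ENNReal.ofReal ε := by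
    rw [add_sub_cancel, TransInvBanachAlg.wnorm_of_memSob hT hTK]
  obtain ⟨Q, P, D, T', u, hT', hD, hPQ, hQP, had, hQ, hP, hu⟩ := hmain γ η hγ d (hZd d hd) B K hK p
    T ε hpK hp' hε0 (by rwa [inv_mul_le_iff₀ hγ]) hεη hTn
  subst hT'
  have hγε : 0 ≤ γ⁻¹ * ε := by positivity
  have hpow : γ⁻¹ * ε ≤ ε ^ κ := inv_mul_le_rpow hγ hε0 hκ1 hεκ
  have hCpow : C * (γ⁻¹ * ε) ≤ 13 * c * C * ε ^ κ := mul_le_mul hCC hpow hγε (by positivity)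
  have hQs := TransInvBanachAlg.memSob_and_sobNorm_sub_one_le hc1 (by positivity) hQ
  have hPs := TransInvBanachAlg.memSob_and_sobNorm_sub_one_le hc1 (by positivity) hP
  have hDs := TransInvBanachAlg.memDiagInf_diagonal (B := B) (by positivity) hu
  rw [← hD] at hDs
  have hDε : B.sobNorm 0 D.ent ≤ 13 * c * C * ε :=
    hDs.2.trans (mul_le_mul_of_nonneg_right hCC hε0)
  refine ⟨Q.ent, P.ent, D.ent, hQs.1, hPs.1, ⟨?_, ?_⟩, hDs.1, LatOp.isTripleProd_of_isAd hPQ had,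
    hQs.2.trans hCpow, hPs.2.trans hCpow, hDε, fun h1 => hDε.trans ?_, fun hTs hps => ?_⟩
  · rw [← LatOp.ent_one, ← hQP]
    exact Q.isProd P
  · rw [← LatOp.ent_one, ← hPQ]
    exact P.isProd Q
  · refine mul_le_mul_of_nonneg_left ?_ (by positivity)
    rcases hε0.eq_or_lt with h0 | h0
    · rw [← h0]
      exact Real.rpow_nonneg le_rfl _
    · exact Real.self_le_rpow_of_le_one h0.le hε1 (div_le_one_of_le₀ h1 (by linarith))
  · have hKr := hreal hTs hps
    subst hKr
    have hv : IsAlgWeight (expWeight c (α - τ - 7 * δ) 0 : ZLat d → ℝ) :=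
      isAlgWeight_expWeight hZ (hZd d hd) hα₀.le hs hc le_rfl
    have hdist : ∀ i j, i ≠ j → p i + u i - (p j + u j) ≠ 0 := fun i j hij => by
      have h1 : C * ε ≤ η := by
        rw [le_div_iff₀ hC] at hεC
        linarith
      have := (hp' u (hu.trans (ENNReal.ofReal_le_ofReal h1)) (i - j) (sub_ne_zero.2 hij)).1 i
      simpa [latShift] using this
    have hθ : C * (γ⁻¹ * ε) ≤ 1 / 6 := by
      rw [le_div_iff₀ (by positivity)] at hεθ
      rw [mul_left_comm, inv_mul_le_iff₀ hγ]
      linarith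
    obtain ⟨G, S, U, hG, hS, hU, hUu, hUi, hUt, hSn, hUn⟩ :=
      TransInvBanachAlg.exists_unitary_reducibility hv hdist hD hQP had hTs.2
        (by positivity) hθ hQ
    rw [expWeight_zero] at hSn hUn
    have hSs := TransInvBanachAlg.memSob_and_sobNorm_sub_one_le hc1 (by positivity) hSn
    have hUs := TransInvBanachAlg.memSob_and_sobNorm_sub_one_le hc1 (by positivity) hUn
    refine ⟨G.ent, S.ent, U.ent, hG, hSs.1, hS, hU, hUs.1, hUu, hUi, hUt, hUs.2.trans ?_⟩
    rw [← mul_assoc]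
    exact mul_le_mul_of_nonneg_left hpow (by positivity)
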